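/- Let $n=n_1+\dots+n_k$ and let $A\subseteq\mathbb{Z}^n$ be a finite set such that $P:=\operatorname{conv}(A)=\Delta_1\times\dots\times\Delta_k\subseteq\mathbb{R}^{n_1}\times\dots\times\mathbb{R}^{n_k}=\mathbb{R}^n$, where $\Delta_j\subseteq\mathbb{R}^{n_j}$ is an $n_j$-dimensional simplex with vertices $a^{(j)}_1,\dots,a^{(j)}_{n_j+1}\in\mathbb{Z}^{n_j}$. Let $f=\sum_{a\in A}c_at^a\in\mathbb{R}[t_1^{\pm},\dots,t_n^{\pm}]$ be a Laurent polynomial with support contained in $A$, and let $\operatorname{Newt}(f)$ be the convex hull of its support. Notation. - $Y_{\hat A}\subseteq\mathbb{C}^A$ is the Zariski closure of $\{(ut^a)_{a\in A} : u\in\mathbb{C}^*,\ t\in(\mathbb{C}^*)^n\}$, and $f$ is strictly $A$-copositive if $\sum_{a\in A}c_ay_a>0$ for all $y\in (Y_{\hat A}\cap\mathbb{R}^A_{\ge0})\setminus\{0\}$. - $\Sigma_A$ is the inner normal fan of $P$, $\Sigma_A(n)$ is the set of its $n$-dimensional cones, $F_1,\dots,F_r\in\mathbb{Z}^n$ are the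 primitive generators of its rays, $F=(F_1\,|\cdots|\,F_r)$, and $b_i=-\min_{a\in A}F_i\cdot a$, so that $P=\{p : F^\top p+b\ge0\}$. The primitive collections are the sets $C\subseteq[r]$ such that $\{F_i\}_{i\in C}$ is not contained in any cone of $\Sigma_A$, but $\{F_i\}_{i\in D}$ is contained in a cone of $\Sigma_A$ for every proper subset $D\subsetneq C$. For $\sigma\in\Sigma_A$, $i\notin\sigma$ means $F_i\notin\sigma$. - $f_{\mathrm{cox}}(x)=\sum_{a\in A}c_ax^{F^\top a+b}\in\mathbb{R}[x_1,\dots,x_r]$. - $v\in\mathbb{Z}^r_{>0}$ is defined as follows. If $F_i$ is the normal of the facet of $P$ coming from the facet of $\Delta_j$ opposite to $a^{(j)}_l$, then $v_i=\dfrac{|\det M_j|}{F_i^{(j)}\cdot a^{(j)}_l+b_i}$, where $M_j$ is the matrix with columns $a^{(j)}_1-a^{(j)}_{n_j+1},\dots,a^{(j)}_{n_j}-a^{(j)}_{n_j+1}$ and $F_i^{(j)}\in\mathbb{Z}^{n_j}$ is the $j$-th block of $F_i$. (This is the lattice volume of that facet of $\Delta_j$.) We write $f_{\mathrm{cox}}(x^v)=f_{\mathrm{cox}}(x_1^{v_1},\dots,x_r^{v_r})$.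 - $h=\sum_{\sigma\in\Sigma_A(n)}\prod_{i\notin\sigma}x_i$. Then the following are equivalent: (i) $f$ is strictly $A$-copositive. (ii) $\operatorname{Newt}(f)=\operatorname{conv}(A)$, and there are $N_C\in\mathbb{N}$, one for each primitive collection $C$, such that $\prod_{C}\bigl(\sum_{i\in C}x_i\bigr)^{N_C}f_{\mathrm{cox}}(x^v)$ has nonnegative coefficients. (iii) $\operatorname{Newt}(f)=\operatorname{conv}(A)$, and there is $N\in\mathbb{N}$ such that $h^Nf_{\mathrm{cox}}(x^v)$ has positive coefficients, that is, the coefficient of $x^{m+e}$ is positive for every exponent $m$ occurring in $h^N$ and every $e=\bigl(v_i(F_i\cdot a+b_i)\bigr)_{i\in[r]}$ with $a\in A$ (no other monomials can occur). (iii') $\operatorname{Newt}(f)=\operatorname{conv}(A)$, and there is $N\in\mathbb{N}$ such that $h^Nf_{\mathrm{cox}}(x^v)$ has nonnegative coefficients. -/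

import Mathlib

namespace SparseCox

open MvPolynomial

section Polytopes

variable {ι : Type*} [Fintype ι]

/-- The inclusion of the lattice `ℤ^ι` into `ℝ^ι`. -/
def toReal {κ : Type*} (a : κ → ℤ) : κ → ℝ := fun i => (a i : ℝ)

/-- `conv(A)` for a finite set `A` of lattice points. -/
def polytope (A : Finset (ι → ℤ)) : Set (ι → ℝ) :=
  convexHull ℝ (toReal '' (A : Set (ι → ℤ)))

/-- The set of points of `P` at which the linear functional `w` is minimal over `P`:
the face of `P` with inner normal vector `w`. -/
def face (P : Set (ι → ℝ)) (w : ι → ℝ) : Set (ι → ℝ) :=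
  {p | p ∈ P ∧ ∀ q ∈ P, w ⬝ᵥ p ≤ w ⬝ᵥ q}

/-- The nonempty faces of `P` (including `P` itself, for `w = 0`). -/
def faces (P : Set (ι → ℝ)) : Set (Set (ι → ℝ)) :=
  {G | G.Nonempty ∧ ∃ w, G = face P w}

/-- The cone of the inner normal fan attached to the face `G`: all functionals that are minimal
over `P` at every point of `G`. -/
def normalCone (P G : Set (ι → ℝ)) : Set (ι → ℝ) := {w | G ⊆ face P w}

/-- The inner normal fan of `P`, as a set of cones. -/
def normalFan (P : Set (ι → ℝ)) : Set (Set (ι → ℝ)) := normalCone P '' faces P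

/-- The dimension of a cone: the dimension of its linear span. -/
noncomputable def coneDim (σ : Set (ι → ℝ)) : ℕ :=
  Module.finrank ℝ (Submodule.span ℝ σ)

/-- `u` is the first lattice point on a ray (a cone of dimension one) of the inner normal fan
of `P`: it is a primitive lattice vector and the half-line it spans is a cone of the fan. -/
def IsRayGenerator (P : Set (ι → ℝ)) (u : ι → ℤ) : Prop :=
  Finset.univ.gcd u = 1 ∧ {w | ∃ c : ℝ, 0 ≤ c ∧ w = c • toReal u} ∈ normalFan P

theorem faces_polytope_finite (A : Finset (ι → ℤ)) : (faces (polytope A)).Finite := by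
  have hfin : (toReal '' (A : Set (ι → ℤ))).Finite := A.finite_toSet.image _
  have hcomp : IsCompact (polytope A) := hfin.isCompact_convexHull ℝ
  have hconv : Convex ℝ (polytope A) := convex_convexHull ℝ _
  have key : ∀ G ∈ faces (polytope A),
      G = closure (convexHull ℝ (G ∩ (polytope A).extremePoints ℝ)) := by
    rintro G ⟨-, w, rfl⟩
    have hexp : IsExposed ℝ (polytope A) (face (polytope A) w) := by
      intro _
      refine ⟨-(LinearMap.toContinuousLinearMap (dotProductBilin ℝ ℝ w)), ?_⟩
      ext p
      simp [face]
    rw [← hexp.isExtreme.extremePoints_eq,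
      closure_convexHull_extremePoints (hexp.isCompact hcomp) (hexp.convex hconv)]
  have hext : ((polytope A).extremePoints ℝ).Finite :=
    hfin.subset extremePoints_convexHull_subset
  refine Set.Finite.subset (hext.finite_subsets.image fun S => closure (convexHull ℝ S)) ?_
  intro G hG
  exact ⟨G ∩ (polytope A).extremePoints ℝ, Set.inter_subset_right, (key G hG).symm⟩

theorem normalFan_polytope_finite (A : Finset (ι → ℤ)) : (normalFan (polytope A)).Finite :=
  (faces_polytope_finite A).image _

open Classical in
/-- The maximal cones `Σ_A(n)` of the inner normal fan `Σ_A` of `conv(A)`, `n = #ι`. -/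
noncomputable def maximalCones (A : Finset (ι → ℤ)) : Finset (Set (ι → ℝ)) :=
  (normalFan_polytope_finite A).toFinset.filter fun σ => coneDim σ = Fintype.card ι

/-- The constant `b` such that `u ⬝ᵥ p + b ≥ 0` is a supporting inequality of `conv(A)`:
minus the minimum of `u` over `A`. -/
noncomputable def supportConst (A : Finset (ι → ℤ)) (u : ι → ℤ) : ℤ :=
  -sInf ((fun a => u ⬝ᵥ a) '' (A : Set (ι → ℤ)))

end Polytopes

section LaurentPolynomials

variable {ι : Type*} [Fintype ι]

/-- The Newton polytope of a Laurent polynomial. -/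
def newtonPolytope (f : AddMonoidAlgebra ℝ (ι → ℤ)) : Set (ι → ℝ) :=
  polytope f.coeff.support

/-- The affine toric variety `Y_Â ⊆ ℂ^A`: the Zariski closure of the image of
`(u, t) ↦ (u t^a)_{a ∈ A}` on the complex torus. -/
def affineToricVariety (A : Finset (ι → ℤ)) : Set (A → ℂ) :=
  zeroLocus ℂ (vanishingIdeal ℂ
    {y : A → ℂ | ∃ (u : ℂ) (t : ι → ℂ), u ≠ 0 ∧ (∀ i, t i ≠ 0) ∧
      ∀ a : A, y a = u * ∏ i, t i ^ (a : ι → ℤ) i})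

/-- Strict `A`-copositivity of a Laurent polynomial `f = ∑ c_a t^a` supported in `A`: the function
`y ↦ ∑ c_a y_a` it induces is positive on all nonzero points of `Y_Â` with nonnegative real
coordinates. -/
def StrictlyCopositive (A : Finset (ι → ℤ)) (f : AddMonoidAlgebra ℝ (ι → ℤ)) : Prop :=
  ∀ y : A → ℝ, (∀ a, 0 ≤ y a) → y ≠ 0 → (fun a => (y a : ℂ)) ∈ affineToricVariety A →
    0 < ∑ a : A, f.coeff (a : ι → ℤ) * y a

end LaurentPolynomials

section Cox

variable {ι : Type*} [Fintype ι] {r : ℕ}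

/-- The exponent vector `Fᵀ a + b` (nonnegative for `a ∈ A`), where `F i` are the rays. -/
noncomputable def coxExponent (A : Finset (ι → ℤ)) (F : Fin r → ι → ℤ) (a : ι → ℤ) : Fin r → ℕ :=
  fun i => (F i ⬝ᵥ a + supportConst A (F i)).toNat

/-- The Cox homogenization `f_cox = ∑_{a ∈ A} c_a x^{Fᵀ a + b}`. -/
noncomputable def coxHom (A : Finset (ι → ℤ)) (F : Fin r → ι → ℤ)
    (f : AddMonoidAlgebra ℝ (ι → ℤ)) : MvPolynomial (Fin r) ℝ :=
  ∑ a ∈ A, monomial (Finsupp.equivFunOnFinite.symm (coxExponent A F a)) (f.coeff a)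

/-- The substitution `p ↦ p(x^v) = p(x_1^{v_1}, …, x_r^{v_r})`. -/
noncomputable def powSubst (v : Fin r → ℕ) (p : MvPolynomial (Fin r) ℝ) :
    MvPolynomial (Fin r) ℝ :=
  bind₁ (fun i => X i ^ v i) p

open Classical in
/-- The primitive collections of rays in the normal fan of `conv(A)`: the sets `C` of (indices of)
rays that do not all lie in a common cone of the fan while every proper subset of `C` does. -/
noncomputable def primitiveCollections (A : Finset (ι → ℤ)) (F : Fin r → ι → ℤ) :
    Finset (Finset (Fin r)) :=
  Finset.univ.filter fun C =>
    (¬ ∃ σ ∈ normalFan (polytope A), ∀ i ∈ C, toReal (F i) ∈ σ) ∧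
      ∀ D ⊂ C, ∃ σ ∈ normalFan (polytope A), ∀ i ∈ D, toReal (F i) ∈ σ

open Classical in
/-- The sum `∑_{σ ∈ Σ_A(n)} ∏_{i ∉ σ} x_i` of the generators of the irrelevant ideal. -/
noncomputable def irrelevantSum (A : Finset (ι → ℤ)) (F : Fin r → ι → ℤ) :
    MvPolynomial (Fin r) ℝ :=
  ∑ σ ∈ maximalCones A, ∏ i ∈ Finset.univ.filter (fun i => toReal (F i) ∉ σ), X i

/-- The polynomial `p` has nonnegative coefficients. -/
def NonnegCoeffs (p : MvPolynomial (Fin r) ℝ) : Prop := ∀ m, 0 ≤ p.coeff m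

end Cox

section ProductOfSimplices

variable {k : ℕ} {d : Fin k → ℕ}

/-- The product `Δ_1 × ⋯ × Δ_k` in `ℝ^{d_1} × ⋯ × ℝ^{d_k}`, where `Δ_j` is the convex hull of the
lattice points `s j 0, …, s j (d j)`. -/
def simplexProduct (s : ∀ j, Fin (d j + 1) → Fin (d j) → ℤ) : Set ((Σ j, Fin (d j)) → ℝ) :=
  {p | ∀ j, (fun m => p ⟨j, m⟩) ∈ convexHull ℝ (Set.range fun l => toReal (s j l))}

/-- The facet of `Δ_1 × ⋯ × Δ_k` that comes from the facet of `Δ_j` opposite to its vertex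
`s j l`. -/
def oppositeFacet (s : ∀ j, Fin (d j + 1) → Fin (d j) → ℤ) (j : Fin k) (l : Fin (d j + 1)) :
    Set ((Σ j, Fin (d j)) → ℝ) :=
  {p | p ∈ simplexProduct s ∧
    (fun m => p ⟨j, m⟩) ∈ convexHull ℝ ((fun l' => toReal (s j l')) '' {l' | l' ≠ l})}

/-- The matrix with columns `s l - s (last)`, for `l` different from the last index. -/
def edgeMatrix {e : ℕ} (s : Fin (e + 1) → Fin e → ℤ) : Matrix (Fin e) (Fin e) ℤ :=
  Matrix.of fun m l => s l.castSucc m - s (Fin.last e) m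

open Classical in
/-- For the ray `u` normal to the facet coming from the facet of `Δ_j` opposite to `s j l`, this is
`|det M_j| / (u ⬝ᵥ s_{j,l} + b)`, the lattice volume of that facet of `Δ_j`. Exactly one pair
`(j, l)` contributes to the sum, and the division is exact. -/
noncomputable def facetVolume (s : ∀ j, Fin (d j + 1) → Fin (d j) → ℤ)
    (A : Finset ((Σ j, Fin (d j)) → ℤ)) (u : (Σ j, Fin (d j)) → ℤ) : ℕ :=
  ∑ j, ∑ l, if face (polytope A) (toReal u) = oppositeFacet s j l then
    (edgeMatrix (s j)).det.natAbs / ((∑ m, u ⟨j, m⟩ * s j l m) + supportConst A u).natAbs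
  else 0

end ProductOfSimplices

end SparseCox

/-! For q = (j, l) let λ_q be the barycentric coordinate of Δ_j at its l-th vertex, and let V_j =
|det M_j|. The rays of the normal fan are spanned by the gradients of the λ_q; factors of dimension
zero contribute none. The weights v make the exponent of x_i in f_cox(x^v) at `a` equal to V_j
λ_q(a) (`exists_isRayIndex`, `facetVolume_mul_eq`). Since the λ_q of one factor sum to 1, f_cox(x^v)
is homogeneous of degree V_j in the block of variables belonging to Δ_j. The primitive collections
are exactly these blocks, and h is the product of the block sums, so all the certificates use the
same multiplier up to the choice of exponents.

From copositivity to certificates: the monomial vector of a nonnegative x lies in Y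
(`monomial_mem_affineToricVariety`) and is nonzero if no block of x vanishes. Hence f_cox(x^v) is
positive on a product of standard simplices, and a blockwise Pólya theorem
(`exists_coeff_prod_blockSum_pow_mul_pos`) gives positive coefficients. Evaluation at 0/1 points
that isolate one vertex shows that the vertex coefficients of f are positive, so its Newton polytope
is everything.

From certificates to copositivity: the binomial equations of Y show that a nonzero nonnegative point
y has a positive coordinate at some vertex w and is, up to scaling, the monomial vector of some x ≥
0 with x_i = 1 at the variables of w (`exists_vertex_ne_zero`, `exists_cox_coordinates`). A
polynomial with nonnegative coefficients is monotone on the orthant, so its value at x is at least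
its value at the 0/1 indicator of w. That value is nonnegative, and it is a positive number times
the coefficient c_w, which is nonzero because the Newton polytope is full. Thus the product, and
with it f_cox(x^v), is positive at x. -/

namespace SparseCox

open MvPolynomial

/-! ### Barycentric coordinates and the normal fan of a product of simplices. -/

section BarycentricCoordinates

variable {k : ℕ} {d : Fin k → ℕ} {s : ∀ j, Fin (d j + 1) → Fin (d j) → ℤ}

/-- The vertices of a simplex of full dimension as an affine basis. -/
noncomputable def simplexBasis (hs : ∀ j, AffineIndependent ℝ fun l => toReal (s j l)) (j : Fin k) :
    AffineBasis (Fin (d j + 1)) ℝ (Fin (d j) → ℝ) where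
  toFun := fun l => toReal (s j l)
  ind' := hs j
  tot' := by
    rw [(hs j).affineSpan_eq_top_iff_card_eq_finrank_add_one]
    simp

theorem simplexBasis_apply (hs : ∀ j, AffineIndependent ℝ fun l => toReal (s j l)) (j : Fin k)
    (l : Fin (d j + 1)) : simplexBasis hs j l = toReal (s j l) := rfl

/-- The barycentric coordinates of the blocks, as affine functions on the whole space. -/
noncomputable def baryCoord (hs : ∀ j, AffineIndependent ℝ fun l => toReal (s j l))
    (q : Σ j, Fin (d j + 1)) : ((Σ j, Fin (d j)) → ℝ) →ᵃ[ℝ] ℝ :=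
  ((simplexBasis hs q.1).coord q.2).comp (LinearMap.funLeft ℝ ℝ (Sigma.mk q.1)).toAffineMap

/-- The gradient of a barycentric coordinate: an inner normal of the opposite facet. -/
noncomputable def baryGrad (hs : ∀ j, AffineIndependent ℝ fun l => toReal (s j l))
    (q : Σ j, Fin (d j + 1)) : (Σ j, Fin (d j)) → ℝ :=
  fun x => (baryCoord hs q).linear (Pi.single x 1)

/-- The vertex of the product of simplices given by one vertex of every factor. -/
def prodVertex (s : ∀ j, Fin (d j + 1) → Fin (d j) → ℤ) (w : ∀ j, Fin (d j + 1)) :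
    (Σ j, Fin (d j)) → ℤ := fun x => s x.1 (w x.1) x.2

/-- The value of the `j`-th block of a linear functional at the vertex `s j l`. -/
def vertexValue (s : ∀ j, Fin (d j + 1) → Fin (d j) → ℤ) (w : (Σ j, Fin (d j)) → ℝ)
    (q : Σ j, Fin (d j + 1)) : ℝ := ∑ m, w ⟨q.1, m⟩ * s q.1 q.2 m


theorem baryCoord_apply (hs : ∀ j, AffineIndependent ℝ fun l => toReal (s j l))
    (q : Σ j, Fin (d j + 1)) (p : (Σ j, Fin (d j)) → ℝ) :
    baryCoord hs q p = (simplexBasis hs q.1).coord q.2 (fun m => p ⟨q.1, m⟩) := rfl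

theorem baryCoord_vertex (hs : ∀ j, AffineIndependent ℝ fun l => toReal (s j l))
    (w : ∀ j, Fin (d j + 1)) (q : Σ j, Fin (d j + 1)) :
    baryCoord hs q (toReal (prodVertex s w)) = if w q.1 = q.2 then 1 else 0 := by
  rw [baryCoord_apply]
  have : (fun m => toReal (prodVertex s w) ⟨q.1, m⟩) = simplexBasis hs q.1 (w q.1) := rfl
  rw [this, AffineBasis.coord_apply]
  simp [eq_comm]

theorem sum_baryCoord (hs : ∀ j, AffineIndependent ℝ fun l => toReal (s j l))
    (j : Fin k) (p : (Σ j, Fin (d j)) → ℝ) :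
    ∑ l, baryCoord hs ⟨j, l⟩ p = 1 := by
  simp only [baryCoord_apply]
  exact (simplexBasis hs j).sum_coord_apply_eq_one _

theorem mem_simplexProduct_iff (hs : ∀ j, AffineIndependent ℝ fun l => toReal (s j l))
    (p : (Σ j, Fin (d j)) → ℝ) :
    p ∈ simplexProduct s ↔ ∀ q, 0 ≤ baryCoord hs q p := by
  rw [Sigma.forall]
  refine forall_congr' fun j => ?_
  have : (Set.range fun l => toReal (s j l)) = Set.range (simplexBasis hs j) := rfl
  rw [this, AffineBasis.convexHull_eq_nonneg_coord]
  rfl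

theorem sum_baryCoord_mul (hs : ∀ j, AffineIndependent ℝ fun l => toReal (s j l))
    (p : (Σ j, Fin (d j)) → ℝ) (x : Σ j, Fin (d j)) :
    ∑ l, baryCoord hs ⟨x.1, l⟩ p * s x.1 l x.2 = p x := by
  have := congrFun ((simplexBasis hs x.1).linear_combination_coord_eq_self fun m => p ⟨x.1, m⟩) x.2
  simpa [baryCoord_apply, simplexBasis_apply, toReal, Finset.sum_apply] using this

theorem baryCoord_linear (hs : ∀ j, AffineIndependent ℝ fun l => toReal (s j l))
    (q : Σ j, Fin (d j + 1)) (p : (Σ j, Fin (d j)) → ℝ) :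
    (baryCoord hs q).linear p = baryGrad hs q ⬝ᵥ p := by
  rw [LinearMap.pi_apply_eq_sum_univ]
  simp only [dotProduct, baryGrad, smul_eq_mul]
  refine Finset.sum_congr rfl fun x _ => ?_
  rw [mul_comm]
  congr 2
  ext y
  simp [Pi.single_apply, eq_comm]

theorem baryGrad_dotProduct_sub (hs : ∀ j, AffineIndependent ℝ fun l => toReal (s j l))
    (q : Σ j, Fin (d j + 1)) (p p' : (Σ j, Fin (d j)) → ℝ) :
    baryGrad hs q ⬝ᵥ p - baryGrad hs q ⬝ᵥ p' = baryCoord hs q p - baryCoord hs q p' := by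
  rw [← dotProduct_sub, ← baryCoord_linear]
  simpa using (baryCoord hs q).linearMap_vsub p p'

theorem dotProduct_eq_sum_baryCoord (hs : ∀ j, AffineIndependent ℝ fun l => toReal (s j l))
    (w p : (Σ j, Fin (d j)) → ℝ) :
    w ⬝ᵥ p = ∑ q, baryCoord hs q p * vertexValue s w q := by
  have : ∀ x, w x * p x = ∑ l, baryCoord hs ⟨x.1, l⟩ p * (w x * s x.1 l x.2) := by
    intro x
    rw [← sum_baryCoord_mul hs p x, Finset.mul_sum]
    exact Finset.sum_congr rfl fun l _ => by ring
  simp only [dotProduct, this]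
  have key : ∀ j, ∑ m, ∑ l, baryCoord hs ⟨j, l⟩ p * (w ⟨j, m⟩ * s j l m) =
      ∑ l, baryCoord hs ⟨j, l⟩ p * vertexValue s w ⟨j, l⟩ := by
    intro j
    rw [Finset.sum_comm]
    exact Finset.sum_congr rfl fun l _ => by simp only [vertexValue, Finset.mul_sum]
  rw [Fintype.sum_sigma, Fintype.sum_sigma]
  exact Finset.sum_congr rfl fun j _ => key j

theorem dotProduct_prodVertex (u : (Σ j, Fin (d j)) → ℝ) (w : ∀ j, Fin (d j + 1)) :
    u ⬝ᵥ toReal (prodVertex s w) = ∑ j, vertexValue s u ⟨j, w j⟩ := by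
  simp only [dotProduct, Fintype.sum_sigma]
  rfl

/-- This is the derivative in `p` of `dotProduct_eq_sum_baryCoord`. -/
theorem sum_vertexValue_smul_baryGrad (hs : ∀ j, AffineIndependent ℝ fun l => toReal (s j l))
    (w : (Σ j, Fin (d j)) → ℝ) :
    w = ∑ q, vertexValue s w q • baryGrad hs q := by
  ext x
  have h1 := dotProduct_eq_sum_baryCoord hs w (Pi.single x 1)
  have h0 := dotProduct_eq_sum_baryCoord hs w 0
  have h2 : ∀ q, baryGrad hs q x = baryCoord hs q (Pi.single x 1) - baryCoord hs q 0 := by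
    intro q
    rw [← baryGrad_dotProduct_sub]
    simp
  rw [dotProduct_single, mul_one] at h1
  rw [dotProduct_zero] at h0
  rw [h1, ← sub_zero (∑ q, _), h0, ← Finset.sum_sub_distrib]
  simp only [Finset.sum_apply, Pi.smul_apply, smul_eq_mul, h2]
  exact Finset.sum_congr rfl fun q _ => by ring

theorem sum_baryGrad (hs : ∀ j, AffineIndependent ℝ fun l => toReal (s j l))
    (j : Fin k) : ∑ l, baryGrad hs ⟨j, l⟩ = 0 := by
  ext x
  have h2 : ∀ q, baryGrad hs q x = baryCoord hs q (Pi.single x 1) - baryCoord hs q 0 := by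
    intro q
    rw [← baryGrad_dotProduct_sub]
    simp
  simp [Finset.sum_apply, h2, Finset.sum_sub_distrib, sum_baryCoord]

/-- The gradients of one block sum to zero, so a constant per block may be subtracted from the
coefficients. With the blockwise minima as constants, every functional becomes a nonnegative
combination of gradients, supported off its minimal vertices. -/
theorem sum_slack_smul_baryGrad (hs : ∀ j, AffineIndependent ℝ fun l => toReal (s j l))
    (w : (Σ j, Fin (d j)) → ℝ) (c : Fin k → ℝ) :
    w = ∑ q, (vertexValue s w q - c q.1) • baryGrad hs q := by
  conv_lhs => rw [sum_vertexValue_smul_baryGrad hs w]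
  simp only [sub_smul, Finset.sum_sub_distrib]
  rw [eq_comm, sub_eq_self, Fintype.sum_sigma]
  refine Finset.sum_eq_zero fun j _ => ?_
  dsimp only
  rw [← Finset.smul_sum, sum_baryGrad, smul_zero]

theorem vertexValue_baryGrad_sub (hs : ∀ j, AffineIndependent ℝ fun l => toReal (s j l))
    (q : Σ j, Fin (d j + 1)) (j : Fin k) (l l' : Fin (d j + 1)) :
    vertexValue s (baryGrad hs q) ⟨j, l⟩ - vertexValue s (baryGrad hs q) ⟨j, l'⟩ =
      (if q = ⟨j, l⟩ then 1 else 0) - (if q = ⟨j, l'⟩ then 1 else 0) := by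
  -- The vertices chosen in the other blocks are arbitrary: their contribution cancels in the
  -- difference.
  have key : ∀ l, baryGrad hs q ⬝ᵥ toReal (prodVertex s (Function.update 0 j l)) =
      vertexValue s (baryGrad hs q) ⟨j, l⟩ +
        ∑ i ∈ {j}ᶜ, vertexValue s (baryGrad hs q) ⟨i, 0⟩ := by
    intro l
    rw [dotProduct_prodVertex, Fintype.sum_eq_add_sum_compl j]
    congr 1
    · simp
    · refine Finset.sum_congr rfl fun i hi => ?_
      rw [Function.update_of_ne (by simpa using hi)]
      rfl
  have h := baryGrad_dotProduct_sub hs q (toReal (prodVertex s (Function.update 0 j l)))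
    (toReal (prodVertex s (Function.update 0 j l')))
  rw [key, key, baryCoord_vertex, baryCoord_vertex, add_sub_add_right_eq_sub] at h
  rw [h]
  obtain ⟨j', l''⟩ := q
  by_cases hj : j' = j
  · subst hj
    simp [eq_comm]
  · simp [hj]

theorem vertexValue_add (w w' : (Σ j, Fin (d j)) → ℝ) (q : Σ j, Fin (d j + 1)) :
    vertexValue s (w + w') q = vertexValue s w q + vertexValue s w' q := by
  simp [vertexValue, add_mul, Finset.sum_add_distrib]

theorem vertexValue_smul (c : ℝ) (w : (Σ j, Fin (d j)) → ℝ) (q : Σ j, Fin (d j + 1)) :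
    vertexValue s (c • w) q = c * vertexValue s w q := by
  simp [vertexValue, mul_assoc, Finset.mul_sum]

theorem vertexValue_sum {α : Type*} (S : Finset α) (w : α → (Σ j, Fin (d j)) → ℝ)
    (q : Σ j, Fin (d j + 1)) :
    vertexValue s (∑ a ∈ S, w a) q = ∑ a ∈ S, vertexValue s (w a) q := by
  simp only [vertexValue, Finset.sum_apply, Finset.sum_mul]
  rw [Finset.sum_comm]

theorem exists_minimal_vertex (w : (Σ j, Fin (d j)) → ℝ) :
    ∃ t : ∀ j, Fin (d j + 1), ∀ j l, vertexValue s w ⟨j, t j⟩ ≤ vertexValue s w ⟨j, l⟩ := by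
  choose t ht using fun j => Finite.exists_min fun l => vertexValue s w ⟨j, l⟩
  exact ⟨t, ht⟩

/-- The vertices of the factors at which a linear functional is minimal over its block. -/
def minVertices (s : ∀ j, Fin (d j + 1) → Fin (d j) → ℤ) (w : (Σ j, Fin (d j)) → ℝ) :
    Set (Σ j, Fin (d j + 1)) :=
  {q | ∀ l, vertexValue s w q ≤ vertexValue s w ⟨q.1, l⟩}

theorem exists_mem_minVertices (w : (Σ j, Fin (d j)) → ℝ) (j : Fin k) :
    ∃ l, (⟨j, l⟩ : Σ j, Fin (d j + 1)) ∈ minVertices s w := by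
  obtain ⟨t, ht⟩ := exists_minimal_vertex (s := s) w
  exact ⟨t j, fun l => ht j l⟩

theorem minVertices_smul {c : ℝ} (hc : 0 < c) (w : (Σ j, Fin (d j)) → ℝ) :
    minVertices s (c • w) = minVertices s w := by
  ext q
  simp only [minVertices, Set.mem_ofPred_eq, vertexValue_smul]
  exact forall_congr' fun l => mul_le_mul_iff_right₀ hc

theorem minVertices_baryGrad (hs : ∀ j, AffineIndependent ℝ fun l => toReal (s j l))
    (q : Σ j, Fin (d j + 1)) (hq : 0 < d q.1) :
    minVertices s (baryGrad hs q) = {q}ᶜ := by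
  ext ⟨j, l⟩
  simp only [minVertices, Set.mem_ofPred_eq, Set.mem_compl_iff, Set.mem_singleton_iff]
  have h := vertexValue_baryGrad_sub hs q j
  constructor
  · rintro h1 rfl
    have : Nontrivial (Fin (d j + 1)) :=
      Fin.nontrivial_iff_two_le.2 (by simpa using Nat.succ_le_succ hq)
    obtain ⟨l', hl'⟩ := exists_ne l
    have h2 := h l l'
    have h3 := h1 l'
    simp only [↓reduceIte, Sigma.mk.injEq, heq_eq_eq, true_and, hl'.symm] at h2
    linarith
  · intro h1 l'
    have h2 := h l l'
    rw [if_neg (Ne.symm h1)] at h2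
    split_ifs at h2 <;> linarith

theorem vertex_mem_simplexProduct (w : ∀ j, Fin (d j + 1)) :
    toReal (prodVertex s w) ∈ simplexProduct s := by
  intro j
  exact subset_convexHull _ _ ⟨w j, rfl⟩

/-- The excess of `w` at `p` over its minimum is the sum of the λ_q(p) times the slack of `w` at q.
All terms are nonnegative, so minimality forces each of them to vanish. -/
theorem mem_face_iff (hs : ∀ j, AffineIndependent ℝ fun l => toReal (s j l))
    (w p : (Σ j, Fin (d j)) → ℝ) :
    p ∈ face (simplexProduct s) w ↔
      p ∈ simplexProduct s ∧ ∀ q, baryCoord hs q p ≠ 0 → q ∈ minVertices s w := by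
  obtain ⟨t, ht⟩ := exists_minimal_vertex (s := s) w
  have hlow : ∀ p, w ⬝ᵥ p - w ⬝ᵥ toReal (prodVertex s t) =
      ∑ q : Σ j, Fin (d j + 1),
        baryCoord hs q p * (vertexValue s w q - vertexValue s w ⟨q.1, t q.1⟩) := by
    intro p
    rw [dotProduct_eq_sum_baryCoord hs w p, dotProduct_prodVertex]
    simp only [mul_sub, Finset.sum_sub_distrib]
    congr 1
    rw [Fintype.sum_sigma]
    refine Finset.sum_congr rfl fun j _ => ?_
    simp [← Finset.sum_mul, sum_baryCoord]
  have hnn : ∀ p ∈ simplexProduct s, ∀ q : Σ j, Fin (d j + 1),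
      0 ≤ baryCoord hs q p * (vertexValue s w q - vertexValue s w ⟨q.1, t q.1⟩) := by
    intro p hp q
    exact mul_nonneg ((mem_simplexProduct_iff hs p).1 hp q) (sub_nonneg.2 (ht q.1 q.2))
  refine and_congr_right fun hp => ⟨fun h q hq => ?_, fun h p' hp' => ?_⟩
  · have h1 := h _ (vertex_mem_simplexProduct t)
    have h2 := hlow p
    have h3 := Finset.single_le_sum (fun q _ => hnn p hp q) (Finset.mem_univ q)
    have h4 := hnn p hp q
    have h5 : baryCoord hs q p * (vertexValue s w q - vertexValue s w ⟨q.1, t q.1⟩) = 0 := by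
      linarith
    intro l
    have h6 := (mul_eq_zero.1 h5).resolve_left hq
    have h7 := ht q.1 l
    linarith
  · have h1 := hlow p
    have h2 := hlow p'
    rw [Finset.sum_eq_zero] at h1
    · have := Finset.sum_nonneg fun q (_ : q ∈ Finset.univ) => hnn p' hp' q
      linarith
    · intro q _
      by_cases hq : baryCoord hs q p = 0
      · simp [hq]
      · have h3 := h q hq (t q.1)
        have h4 := ht q.1 q.2
        rw [le_antisymm h3 h4]
        simp

/-- The functionals that are minimal at all vertices in `T`. -/
def vertexCone (s : ∀ j, Fin (d j + 1) → Fin (d j) → ℤ) (T : Set (Σ j, Fin (d j + 1))) :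
    Set ((Σ j, Fin (d j)) → ℝ) := {w | T ⊆ minVertices s w}

/-- Any minimal vertex of one block extends, by minimal vertices of the others, to a vertex of the
face, so a face remembers its minimal vertices. -/
theorem face_subset_face_iff (hs : ∀ j, AffineIndependent ℝ fun l => toReal (s j l))
    (w w' : (Σ j, Fin (d j)) → ℝ) :
    face (simplexProduct s) w ⊆ face (simplexProduct s) w' ↔
      minVertices s w ⊆ minVertices s w' := by
  constructor
  · intro h q hq
    obtain ⟨t, ht⟩ := exists_minimal_vertex (s := s) w
    have hv : toReal (prodVertex s (Function.update t q.1 q.2)) ∈ face (simplexProduct s) w := by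
      refine (mem_face_iff hs _ _).2 ⟨vertex_mem_simplexProduct _, fun q' hq' => ?_⟩
      rw [baryCoord_vertex] at hq'
      have h1 : Function.update t q.1 q.2 q'.1 = q'.2 := by
        by_contra h
        simp [h] at hq'
      obtain ⟨j', l'⟩ := q'
      obtain ⟨j, l⟩ := q
      by_cases hj : j' = j
      · subst hj
        simp only [Function.update_self] at h1
        rwa [← h1]
      · simp only [Function.update_of_ne hj] at h1
        rw [← h1]
        exact fun l => ht j' l
    refine ((mem_face_iff hs _ _).1 (h hv)).2 q ?_
    rw [baryCoord_vertex]
    simp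
  · intro h p hp
    rw [mem_face_iff hs] at hp ⊢
    exact ⟨hp.1, fun q hq => h (hp.2 q hq)⟩

theorem exists_minVertices_eq (hs : ∀ j, AffineIndependent ℝ fun l => toReal (s j l))
    (T : Set (Σ j, Fin (d j + 1)))
    (hT : ∀ j, ∃ l, (⟨j, l⟩ : Σ j, Fin (d j + 1)) ∈ T) : ∃ w, minVertices s w = T := by
  classical
  -- Up to a constant in each block, the sum of the gradients outside `T` takes the value 0 on `T`
  -- and 1 off `T`.
  refine ⟨∑ q : Σ j, Fin (d j + 1), if q ∈ T then 0 else baryGrad hs q, ?_⟩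
  have key : ∀ j l l', vertexValue s (∑ q : Σ j, Fin (d j + 1), if q ∈ T then 0 else baryGrad hs q)
        ⟨j, l⟩ -
      vertexValue s (∑ q : Σ j, Fin (d j + 1), if q ∈ T then 0 else baryGrad hs q) ⟨j, l'⟩ =
      (if (⟨j, l⟩ : Σ j, Fin (d j + 1)) ∈ T then 0 else 1) -
        (if (⟨j, l'⟩ : Σ j, Fin (d j + 1)) ∈ T then 0 else (1 : ℝ)) := by
    intro j l l'
    have h0 : ∀ q, vertexValue s 0 q = 0 := fun q => by simp [vertexValue]
    have : ∀ q : Σ j, Fin (d j + 1), vertexValue s (if q ∈ T then 0 else baryGrad hs q) ⟨j, l⟩ -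
        vertexValue s (if q ∈ T then 0 else baryGrad hs q) ⟨j, l'⟩ =
        (if q = ⟨j, l⟩ then (if q ∈ T then 0 else 1) else 0) -
          (if q = ⟨j, l'⟩ then (if q ∈ T then 0 else 1) else 0) := by
      intro q
      by_cases hq : q ∈ T
      · simp [hq, h0]
      · simp only [hq, if_false, vertexValue_baryGrad_sub]
    rw [vertexValue_sum, vertexValue_sum, ← Finset.sum_sub_distrib,
      Finset.sum_congr rfl fun q _ => this q, Finset.sum_sub_distrib]
    simp
  ext ⟨j, l⟩
  simp only [minVertices, Set.mem_ofPred_eq]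
  constructor
  · intro h
    by_contra hl
    obtain ⟨l', hl'⟩ := hT j
    have h1 := key j l l'
    have h2 := h l'
    rw [if_neg hl, if_pos hl'] at h1
    linarith
  · intro hl l'
    have h1 := key j l l'
    rw [if_pos hl] at h1
    split_ifs at h1 <;> linarith

/-- Faces, hence cones, correspond to the sets of vertices that meet every block; this reduces all
questions about the fan to combinatorics. -/
theorem mem_normalFan_iff (hs : ∀ j, AffineIndependent ℝ fun l => toReal (s j l))
    (σ : Set ((Σ j, Fin (d j)) → ℝ)) :
    σ ∈ normalFan (simplexProduct s) ↔
      ∃ T : Set (Σ j, Fin (d j + 1)), (∀ j, ∃ l, (⟨j, l⟩ : Σ j, Fin (d j + 1)) ∈ T) ∧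
        σ = vertexCone s T := by
  have hcone : ∀ w, normalCone (simplexProduct s) (face (simplexProduct s) w) =
      vertexCone s (minVertices s w) := by
    intro w
    ext w'
    exact face_subset_face_iff hs w w'
  constructor
  · rintro ⟨G, ⟨-, w, rfl⟩, rfl⟩
    exact ⟨minVertices s w, exists_mem_minVertices w, hcone w⟩
  · rintro ⟨T, hT, rfl⟩
    obtain ⟨w, rfl⟩ := exists_minVertices_eq hs T hT
    refine ⟨face (simplexProduct s) w, ⟨?_, w, rfl⟩, hcone w⟩
    obtain ⟨t, ht⟩ := exists_minimal_vertex (s := s) w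
    refine ⟨toReal (prodVertex s t), (mem_face_iff hs _ _).2 ⟨vertex_mem_simplexProduct t, ?_⟩⟩
    rintro ⟨j, l⟩ hq
    rw [baryCoord_vertex] at hq
    have h1 : t j = l := by
      by_contra h
      simp [h] at hq
    rw [← h1]
    exact fun l => ht j l

end BarycentricCoordinates

/-! ### Pólya's theorem for multihomogeneous forms. -/

section Polya

open scoped Nat

variable {σ J : Type*} [Fintype σ] [Fintype J] [DecidableEq J]

/-- The sum of the variables in the `j`-th block of a partition `π` of the variables. -/
noncomputable def blockSum (π : σ → J) (j : J) : MvPolynomial σ ℝ := ∑ i with π i = j, X i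

/-- The coefficients of `q` are those of the product of the `N j`-th powers of the block sums. -/
def HasMultinomialCoeffs (π : σ → J) (N : J → ℕ) (q : MvPolynomial σ ℝ) : Prop :=
  ∀ m : σ →₀ ℕ, q.coeff m * ∏ i, ((m i)! : ℝ) =
    if ∀ j, ∑ i with π i = j, m i = N j then ∏ j, ((N j)! : ℝ) else 0

theorem hasMultinomialCoeffs_one (π : σ → J) : HasMultinomialCoeffs π 0 1 := by
  classical
  intro m
  rw [coeff_one]
  by_cases hm : 0 = m
  · subst hm
    simp
  · rw [if_neg hm, if_neg, zero_mul]
    intro h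
    refine hm (Finsupp.ext fun i => ?_)
    have := (Finset.sum_eq_zero_iff.1 (h (π i))) i (by simp)
    simpa using this.symm

/-- Multiplying by x_i turns 1/(m_i - 1)! into m_i/m_i!; summing m_i over the block gives the factor
N_j + 1 that completes the new factorial. -/
theorem HasMultinomialCoeffs.blockSum_mul {π : σ → J} {N : J → ℕ} {q : MvPolynomial σ ℝ}
    (h : HasMultinomialCoeffs π N q) (j : J) :
    HasMultinomialCoeffs π (N + Pi.single j 1) (blockSum π j * q) := by
  classical
  intro m
  have term : ∀ i, π i = j → (X i * q).coeff m * ∏ i, ((m i)! : ℝ) =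
      m i * if ∀ j', ∑ i with π i = j', m i = (N + Pi.single j 1 : J → ℕ) j' then ∏ j, ((N j)! : ℝ)
        else 0 := by
    intro i hi
    rw [coeff_X_mul']
    by_cases him : i ∈ m.support
    · obtain ⟨m', rfl⟩ : ∃ m', m = m' + Finsupp.single i 1 := by
        refine ⟨m - Finsupp.single i 1, ?_⟩
        rw [tsub_add_cancel_of_le]
        rw [Finsupp.single_le_iff]
        exact Nat.one_le_iff_ne_zero.2 (Finsupp.mem_support_iff.1 him)
      rw [if_pos him, add_tsub_cancel_right]
      have h1 : ∏ i', (((m' + Finsupp.single i 1 : σ →₀ ℕ) i')! : ℝ) =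
          (m' i + 1 : ℕ) * ∏ i', ((m' i')! : ℝ) := by
        rw [Fintype.prod_eq_mul_prod_compl i, Fintype.prod_eq_mul_prod_compl i, ← mul_assoc]
        congr 1
        · simp [Nat.factorial_succ]
        · refine Finset.prod_congr rfl fun i' hi' => ?_
          have : i ≠ i' := by simpa [eq_comm] using hi'
          simp [this]
      have h2 : (∀ j', ∑ i' with π i' = j', (m' + Finsupp.single i 1 : σ →₀ ℕ) i' =
          (N + Pi.single j 1 : J → ℕ) j') ↔ ∀ j', ∑ i' with π i' = j', m' i' = N j' := by
        refine forall_congr' fun j' => ?_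
        simp only [Finsupp.add_apply, Finset.sum_add_distrib, Pi.add_apply]
        have : ∑ i' with π i' = j', (Finsupp.single i 1 : σ →₀ ℕ) i' =
            (Pi.single j 1 : J → ℕ) j' := by
          simp only [Finsupp.single_apply, Finset.sum_ite_eq, Finset.mem_filter, Finset.mem_univ,
            true_and, Pi.single_apply, hi, eq_comm]
        rw [this, add_left_inj]
      rw [h1, mul_left_comm, h m', if_congr h2 rfl rfl]
      simp
    · rw [if_neg him, Finsupp.notMem_support_iff.1 him]
      simp
  rw [blockSum, Finset.sum_mul, coeff_sum, Finset.sum_mul,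
    Finset.sum_congr rfl fun i hi => term i (Finset.mem_filter.1 hi).2, ← Finset.sum_mul]
  split_ifs with hm
  · have h1 := hm j
    rw [← Nat.cast_sum, h1, Fintype.prod_eq_mul_prod_compl j, ← mul_assoc]
    refine Eq.trans ?_ (Fintype.prod_eq_mul_prod_compl j _).symm
    congr 1
    · simp [Nat.factorial_succ]
    · refine Finset.prod_congr rfl fun j' hj' => ?_
      have : j' ≠ j := by simpa using hj'
      simp [this]
  · simp

theorem hasMultinomialCoeffs_prod_pow (π : σ → J) (N : ℕ) :
    HasMultinomialCoeffs π (fun _ => N) ((∏ j, blockSum π j) ^ N) := by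
  classical
  induction N with
  | zero => simpa using! hasMultinomialCoeffs_one π
  | succ N ih =>
    -- The passage from N to N + 1 is made one block at a time, with `S` the blocks already
    -- multiplied.
    have key : ∀ S : Finset J, HasMultinomialCoeffs π (fun j => N + if j ∈ S then 1 else 0)
        ((∏ j ∈ S, blockSum π j) * (∏ j, blockSum π j) ^ N) := by
      intro S
      induction S using Finset.induction_on with
      | empty => simpa using ih
      | insert j S hj ihS =>
        rw [Finset.prod_insert hj, mul_assoc]
        convert ihS.blockSum_mul j using 1
        ext j'
        by_cases h : j' = j
        · subst h
          simp [hj]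
        · simp [h]
    rw [pow_succ']
    simpa using key Finset.univ

theorem HasMultinomialCoeffs.coeff_eq {π : σ → J} {N : J → ℕ} {q : MvPolynomial σ ℝ}
    (h : HasMultinomialCoeffs π N q) {m : σ →₀ ℕ} (hm : ∀ j, ∑ i with π i = j, m i = N j) :
    q.coeff m = (∏ j, ((N j)! : ℝ)) / ∏ i, ((m i)! : ℝ) := by
  rw [eq_div_iff (Finset.prod_ne_zero_iff.2 fun i _ => by positivity), h m, if_pos hm]

theorem HasMultinomialCoeffs.sum_eq_of_mem_support {π : σ → J} {N : J → ℕ}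
    {q : MvPolynomial σ ℝ} (h : HasMultinomialCoeffs π N q) {m : σ →₀ ℕ} (hm : m ∈ q.support)
    (j : J) : ∑ i with π i = j, m i = N j := by
  by_contra hj
  have h1 := h m
  rw [if_neg fun h => hj (h j), mul_eq_zero] at h1
  rcases h1 with h1 | h1
  · exact mem_support_iff.1 hm h1
  · exact (Finset.prod_ne_zero_iff.2 fun i _ => by positivity) h1

theorem cast_descFactorial_eq_prod (n e : ℕ) :
    (n.descFactorial e : ℝ) = ∏ t ∈ Finset.range e, ((n : ℝ) - t) := by
  induction e with
  | zero => simp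
  | succ e ih =>
    rw [Nat.descFactorial_succ, Finset.prod_range_succ, Nat.cast_mul, ih, mul_comm]
    rcases le_or_gt e n with h | h
    · rw [Nat.cast_sub h]
    · rw [← ih, Nat.descFactorial_of_lt h]
      simp

/-- The quotient m!/(m - E)! is a falling factorial. Where `E a` exceeds `m`, the falling factorial
vanishes, in agreement with the missing term. -/
theorem HasMultinomialCoeffs.coeff_mul_sum_monomial {α : Type*} {π : σ → J} {N : J → ℕ}
    {q : MvPolynomial σ ℝ} (h : HasMultinomialCoeffs π N q) (B : Finset α) (c : α → ℝ)
    (E : α → σ → ℕ) (D : J → ℕ) (hE : ∀ a ∈ B, ∀ j, ∑ i with π i = j, E a i = D j)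
    {m : σ →₀ ℕ} (hm : ∀ j, ∑ i with π i = j, m i = N j + D j) :
    (q * ∑ a ∈ B, monomial (Finsupp.equivFunOnFinite.symm (E a)) (c a)).coeff m =
      (∏ j, ((N j)! : ℝ)) / (∏ i, ((m i)! : ℝ)) *
        ∑ a ∈ B, c a * ∏ i, ∏ t ∈ Finset.range (E a i), ((m i : ℝ) - t) := by
  rw [Finset.mul_sum, coeff_sum, Finset.mul_sum]
  refine Finset.sum_congr rfl fun a ha => ?_
  rw [coeff_mul_monomial']
  simp only [← cast_descFactorial_eq_prod]
  split_ifs with hle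
  · have hle' : ∀ i, E a i ≤ m i := fun i => hle i
    rw [h.coeff_eq]
    · have : ∏ i, ((m i)! : ℝ) =
          (∏ i, (((m - Finsupp.equivFunOnFinite.symm (E a) : σ →₀ ℕ) i)! : ℝ)) *
            ∏ i, ((m i).descFactorial (E a i) : ℝ) := by
        rw [← Finset.prod_mul_distrib]
        refine Finset.prod_congr rfl fun i _ => ?_
        rw [← Nat.factorial_mul_descFactorial (hle' i), Nat.cast_mul]
        rfl
      have h1 : ∏ i, ((m i).descFactorial (E a i) : ℝ) ≠ 0 :=
        Finset.prod_ne_zero_iff.2 fun i _ => by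
          simpa [Nat.descFactorial_eq_zero_iff_lt] using hle' i
      have h2 : ∏ i, (((m - Finsupp.equivFunOnFinite.symm (E a) : σ →₀ ℕ) i)! : ℝ) ≠ 0 :=
        Finset.prod_ne_zero_iff.2 fun i _ => by positivity
      rw [this]
      field_simp
    · intro j
      have h1 := hm j
      have h2 : ∑ i with π i = j, (m i - E a i) + ∑ i with π i = j, E a i =
          ∑ i with π i = j, m i := by
        rw [← Finset.sum_add_distrib]
        exact Finset.sum_congr rfl fun i _ => Nat.sub_add_cancel (hle' i)
      rw [hE a ha j, h1] at h2
      exact Nat.add_right_cancel h2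
  · obtain ⟨i, hi⟩ : ∃ i, m i < E a i := by
      by_contra hcon
      push Not at hcon
      exact hle fun i => hcon i
    have h0 : ∏ i, ((m i).descFactorial (E a i) : ℝ) = 0 :=
      Finset.prod_eq_zero (Finset.mem_univ i) (by rw [Nat.descFactorial_of_lt hi, Nat.cast_zero])
    rw [h0, mul_zero, mul_zero]

open Filter Topology in
/-- **Pólya's theorem** for forms that are homogeneous in every block of the variables. -/
theorem exists_coeff_prod_blockSum_pow_mul_pos {α : Type*} (π : σ → J) (B : Finset α) (c : α → ℝ)
    (E : α → σ → ℕ) (D : J → ℕ) (hE : ∀ a ∈ B, ∀ j, ∑ i with π i = j, E a i = D j)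
    (hpos : ∀ x : σ → ℝ, (∀ i, 0 ≤ x i) → (∀ j, ∑ i with π i = j, x i = 1) →
      0 < ∑ a ∈ B, c a * ∏ i, x i ^ E a i) :
    ∃ N : ℕ, ∀ m : σ →₀ ℕ, (∀ j, ∑ i with π i = j, m i = N + D j) →
      0 < ((∏ j, blockSum π j) ^ N *
        ∑ a ∈ B, monomial (Finsupp.equivFunOnFinite.symm (E a)) (c a)).coeff m := by
  set K : Set (σ → ℝ) := {x | (∀ i, 0 ≤ x i) ∧ ∀ j, ∑ i with π i = j, x i = 1} with hK
  have hKc : IsCompact K := by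
    refine (isCompact_univ_pi fun _ : σ => isCompact_Icc (a := (0 : ℝ)) (b := 1)).of_isClosed_subset
      ?_ ?_
    · rw [hK, Set.ofPred_and, Set.ofPred_forall, Set.ofPred_forall]
      refine (isClosed_iInter fun i => ?_).inter (isClosed_iInter fun j => ?_)
      · exact isClosed_le continuous_const (continuous_apply i)
      · exact isClosed_eq (by fun_prop) continuous_const
    · intro x hx i _
      refine ⟨hx.1 i, ?_⟩
      rw [← hx.2 (π i)]
      exact Finset.single_le_sum (fun i _ => hx.1 i) (by simp)
  -- At ε = 0 the perturbed sum is the form itself, which is positive on the compact set `K`;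
  -- compactness makes one neighbourhood of 0 work for all of `K`.
  have hev : ∀ᶠ ε : J → ℝ in 𝓝 0, ∀ x ∈ K,
      0 < ∑ a ∈ B, c a * ∏ i, ∏ t ∈ Finset.range (E a i), (x i - t * ε (π i)) := by
    refine hKc.eventually_forall_of_forall_eventually
      (P := fun (ε : J → ℝ) x =>
        0 < ∑ a ∈ B, c a * ∏ i, ∏ t ∈ Finset.range (E a i), (x i - t * ε (π i))) fun x hx => ?_
    have hcont : Continuous fun z : (J → ℝ) × (σ → ℝ) =>
        ∑ a ∈ B, c a * ∏ i, ∏ t ∈ Finset.range (E a i), (z.2 i - t * z.1 (π i)) := by fun_prop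
    refine hcont.continuousAt.eventually (lt_mem_nhds ?_)
    simpa using hpos x hx.1 hx.2
  have hlim : Tendsto (fun (N : ℕ) (j : J) => ((N : ℝ) + D j)⁻¹) atTop (𝓝 0) := by
    refine tendsto_pi_nhds.2 fun j => ?_
    exact tendsto_inv_atTop_zero.comp
      (tendsto_atTop_add_const_right _ _ tendsto_natCast_atTop_atTop)
  obtain ⟨N, hN, hN0⟩ := ((hlim.eventually hev).and (eventually_gt_atTop 0)).exists
  refine ⟨N, fun m hm => ?_⟩
  rw [(hasMultinomialCoeffs_prod_pow π N).coeff_mul_sum_monomial B c E D hE hm]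
  have hD : ∀ j, (0 : ℝ) < N + D j := fun j => by positivity
  refine mul_pos (div_pos (Finset.prod_pos fun _ _ => by positivity)
    (Finset.prod_pos fun _ _ => by positivity)) ?_
  -- Dividing `m` by its block degrees gives a point of `K` and turns the falling factorials into
  -- the perturbed powers with ε_j = 1/(N + D_j).
  have hx := hN (fun i => m i / (N + D (π i))) ⟨fun i => by positivity, fun j => ?_⟩
  · have hfac : ∑ a ∈ B, c a * ∏ i, ∏ t ∈ Finset.range (E a i), ((m i : ℝ) - t) =
        (∏ j, ((N : ℝ) + D j) ^ D j) * ∑ a ∈ B, c a * ∏ i, ∏ t ∈ Finset.range (E a i),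
          ((m i : ℝ) / (N + D (π i)) - t * (N + D (π i) : ℝ)⁻¹) := by
      rw [Finset.mul_sum]
      refine Finset.sum_congr rfl fun a ha => ?_
      have h1 : ∏ j, ((N : ℝ) + D j) ^ D j = ∏ i, ((N : ℝ) + D (π i)) ^ E a i := by
        rw [← Finset.prod_fiberwise Finset.univ π]
        refine Finset.prod_congr rfl fun j _ => ?_
        rw [← hE a ha j, ← Finset.prod_pow_eq_pow_sum]
        refine Finset.prod_congr rfl fun i hi => ?_
        rw [(Finset.mem_filter.1 hi).2, hE a ha j]
      rw [h1, mul_left_comm, ← Finset.prod_mul_distrib]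
      congr 1
      refine Finset.prod_congr rfl fun i _ => ?_
      rw [← Finset.card_range (E a i), ← Finset.prod_const, Finset.card_range,
        ← Finset.prod_mul_distrib]
      refine Finset.prod_congr rfl fun t _ => ?_
      have := (hD (π i)).ne'
      field_simp
    rw [hfac]
    exact mul_pos (Finset.prod_pos fun j _ => pow_pos (hD j) _) hx
  · have h1 : ∑ i with π i = j, (m i : ℝ) / (N + D (π i)) =
        ∑ i with π i = j, (m i : ℝ) / (N + D j) :=
      Finset.sum_congr rfl fun i hi => by rw [(Finset.mem_filter.1 hi).2]
    rw [h1, ← Finset.sum_div, ← Nat.cast_sum, hm j, Nat.cast_add, div_self (hD j).ne']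

end Polya

/-! ### The rays of the normal fan and their primitive generators. -/

section Rays

variable {k : ℕ} {d : Fin k → ℕ} {s : ∀ j, Fin (d j + 1) → Fin (d j) → ℤ}

theorem exists_ne_of_pos {e : ℕ} (he : 0 < e) (l : Fin (e + 1)) : ∃ l', l' ≠ l := by
  have : Nontrivial (Fin (e + 1)) := Fin.nontrivial_iff_two_le.2 (by omega)
  exact exists_ne l

/-- A left kernel vector of the edge matrix would be a functional constant on the vertices, hence on
the whole space, hence zero. -/
theorem det_edgeMatrix_ne_zero (hs : ∀ j, AffineIndependent ℝ fun l => toReal (s j l))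
    (j : Fin k) : (edgeMatrix (s j)).det ≠ 0 := by
  intro h0
  obtain ⟨z, hz, hzM⟩ := Matrix.exists_vecMul_eq_zero_iff.2 h0
  have hval : ∀ l, toReal z ⬝ᵥ toReal (s j l) = toReal z ⬝ᵥ toReal (s j (Fin.last _)) := by
    intro l
    refine Fin.lastCases rfl (fun l => ?_) l
    have h1 := congrFun hzM l
    rw [← sub_eq_zero, ← dotProduct_sub]
    have h2 : (((z ⬝ᵥ fun m => edgeMatrix (s j) m l) : ℤ) : ℝ) = 0 := by
      rw [show z ⬝ᵥ (fun m => edgeMatrix (s j) m l) = 0 from h1]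
      simp
    rw [← h2]
    simp [dotProduct, toReal, edgeMatrix]
  have hconst : ∀ p : Fin (d j) → ℝ, toReal z ⬝ᵥ p = toReal z ⬝ᵥ toReal (s j (Fin.last _)) := by
    intro p
    have hp := (simplexBasis hs j).linear_combination_coord_eq_self p
    rw [← hp, dotProduct_sum]
    simp only [dotProduct_smul, simplexBasis_apply, hval, smul_eq_mul]
    rw [← Finset.sum_mul, (simplexBasis hs j).sum_coord_apply_eq_one, one_mul]
  have h1 := hconst (toReal z)
  rw [← hconst 0, dotProduct_zero, dotProduct_self_eq_zero] at h1
  refine hz (funext fun m => ?_)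
  have := congrFun h1 m
  simpa [toReal] using this

theorem baryGrad_apply_of_ne (hs : ∀ j, AffineIndependent ℝ fun l => toReal (s j l))
    (q : Σ j, Fin (d j + 1)) (x : Σ j, Fin (d j)) (hx : x.1 ≠ q.1) : baryGrad hs q x = 0 := by
  have : (LinearMap.funLeft ℝ ℝ (Sigma.mk q.1)) (Pi.single x (1 : ℝ)) = (0 : Fin (d q.1) → ℝ) := by
    ext m
    rw [LinearMap.funLeft_apply, Pi.single_eq_of_ne]
    · rfl
    · rintro rfl
      exact hx rfl
  simp [baryGrad, baryCoord, this]

theorem baryGrad_ne_zero (hs : ∀ j, AffineIndependent ℝ fun l => toReal (s j l))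
    (q : Σ j, Fin (d j + 1)) (hq : 0 < d q.1) : baryGrad hs q ≠ 0 := by
  intro h
  have h1 := minVertices_baryGrad hs q hq
  have h2 : q ∈ minVertices s (baryGrad hs q) := by
    rw [h]
    simp [minVertices, vertexValue]
  rw [h1] at h2
  exact h2 rfl

theorem vertexValue_edge (u : (Σ j, Fin (d j)) → ℤ) (j : Fin k) (l : Fin (d j)) :
    vertexValue s (toReal u) ⟨j, l.castSucc⟩ - vertexValue s (toReal u) ⟨j, Fin.last _⟩ =
      ((Matrix.vecMul (fun m => u ⟨j, m⟩) (edgeMatrix (s j)) l : ℤ) : ℝ) := by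
  simp [vertexValue, Matrix.vecMul, dotProduct, toReal, edgeMatrix, mul_sub]

theorem exists_toReal_eq_smul_baryGrad (hs : ∀ j, AffineIndependent ℝ fun l => toReal (s j l))
    (q : Σ j, Fin (d j + 1)) :
    ∃ (u : (Σ j, Fin (d j)) → ℤ) (c : ℝ), 0 < c ∧ toReal u = c • baryGrad hs q := by
  classical
  let z : ∀ j, Fin (d j) → ℤ := fun j l =>
    (if (⟨j, l.castSucc⟩ : Σ j, Fin (d j + 1)) = q then 1 else 0) -
      if (⟨j, Fin.last _⟩ : Σ j, Fin (d j + 1)) = q then 1 else 0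
  let u : (Σ j, Fin (d j)) → ℤ := fun x =>
    ((edgeMatrix (s x.1)).det • Matrix.vecMul (z x.1) (edgeMatrix (s x.1)).adjugate) x.2
  -- The vector `z j` lists the increments of λ_q along the edges, and the adjugate solves for the
  -- gradient up to a factor det. The extra factor det makes the multiplier a square, hence
  -- positive.
  refine ⟨u, ((edgeMatrix (s q.1)).det : ℝ) ^ 2, ?_, ?_⟩
  · have := det_edgeMatrix_ne_zero hs q.1
    positivity
  have hu : ∀ j, Matrix.vecMul (fun m => u ⟨j, m⟩) (edgeMatrix (s j)) =
      (edgeMatrix (s j)).det ^ 2 • z j := by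
    intro j
    change Matrix.vecMul ((edgeMatrix (s j)).det • Matrix.vecMul (z j) (edgeMatrix (s j)).adjugate)
      (edgeMatrix (s j)) = _
    rw [Matrix.smul_vecMul, Matrix.vecMul_vecMul, Matrix.adjugate_mul, Matrix.vecMul_smul,
      Matrix.vecMul_one, smul_smul, sq]
  let c : Fin k → ℝ := fun j => vertexValue s (toReal u) ⟨j, Fin.last _⟩ -
    ((edgeMatrix (s j)).det : ℝ) ^ 2 *
      if (⟨j, Fin.last _⟩ : Σ j, Fin (d j + 1)) = q then 1 else 0
  have hval : ∀ q' : Σ j, Fin (d j + 1), vertexValue s (toReal u) q' - c q'.1 =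
      ((edgeMatrix (s q'.1)).det : ℝ) ^ 2 * if q' = q then 1 else 0 := by
    rintro ⟨j, l⟩
    refine Fin.lastCases (by simp [c]) (fun l => ?_) l
    have h1 := vertexValue_edge (s := s) u j l
    rw [hu j] at h1
    rw [sub_eq_iff_eq_add] at h1
    simp only [c, h1, z, Pi.smul_apply, smul_eq_mul]
    push_cast
    ring
  rw [sum_slack_smul_baryGrad hs (toReal u) c]
  simp only [hval]
  rw [Finset.sum_eq_single q]
  · simp
  · intro q' _ h
    simp [h]
  · simp

theorem isRayGenerator_iff (hs : ∀ j, AffineIndependent ℝ fun l => toReal (s j l))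
    (u : (Σ j, Fin (d j)) → ℤ) :
    IsRayGenerator (simplexProduct s) u ↔ Finset.univ.gcd u = 1 ∧
      ∃ (q : Σ j, Fin (d j + 1)) (c : ℝ), 0 < d q.1 ∧ 0 < c ∧ toReal u = c • baryGrad hs q := by
  refine and_congr_right fun hu => ?_
  rw [mem_normalFan_iff hs]
  constructor
  · rintro ⟨T, hT, hcone⟩
    have huT : toReal u ∈ vertexCone s T := by
      rw [← hcone]
      exact ⟨1, zero_le_one, (one_smul _ _).symm⟩
    -- If `T` were everything, `u` would be constant on each block and therefore zero. For q outside
    -- `T`, the gradient of λ_q lies in the cone, which is the half-line of `u`.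
    obtain ⟨q, hq⟩ : ∃ q, q ∉ T := by
      by_contra hcon
      push Not at hcon
      have h0 : toReal u = 0 := by
        rw [sum_slack_smul_baryGrad hs (toReal u) fun j => vertexValue s (toReal u) ⟨j, 0⟩]
        refine Finset.sum_eq_zero fun q _ => ?_
        have h1 := huT (hcon q) 0
        have h2 := huT (hcon ⟨q.1, 0⟩) q.2
        rw [le_antisymm h1 h2, sub_self, zero_smul]
      have h1 : ∀ x, u x = 0 := fun x => by simpa [toReal] using congrFun h0 x
      rw [Finset.gcd_eq_zero_iff.2 fun x _ => h1 x] at hu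
      exact zero_ne_one hu
    have hd : 0 < d q.1 := by
      rw [Nat.pos_iff_ne_zero]
      intro hd
      obtain ⟨l, hl⟩ := hT q.1
      have hl2 : l = q.2 := Fin.ext (by omega)
      rw [hl2] at hl
      exact hq hl
    have hg : baryGrad hs q ∈ vertexCone s T := by
      change T ⊆ minVertices s _
      rw [minVertices_baryGrad hs q hd]
      rintro q' hq' rfl
      exact hq hq'
    rw [← hcone] at hg
    obtain ⟨c, hc, hgc⟩ := hg
    have hc0 : c ≠ 0 := by
      rintro rfl
      exact baryGrad_ne_zero hs q hd (by rw [hgc, zero_smul])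
    exact ⟨q, c⁻¹, hd, by positivity, by rw [hgc, inv_smul_smul₀ hc0]⟩
  · rintro ⟨q, c, hd, hc, huc⟩
    -- A functional minimal at all vertices except q has slack only there, so it is a nonnegative
    -- multiple of the gradient of λ_q.
    refine ⟨{q}ᶜ, fun j => ?_, ?_⟩
    · by_cases hj : j = q.1
      · subst hj
        obtain ⟨l, hl⟩ := exists_ne_of_pos hd q.2
        exact ⟨l, fun h => hl (eq_of_heq (Sigma.ext_iff.1 h).2)⟩
      · refine ⟨0, ?_⟩
        rintro rfl
        exact hj rfl
    · ext w
      constructor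
      · rintro ⟨c', hc', rfl⟩
        change {q}ᶜ ⊆ minVertices s _
        rcases hc'.eq_or_lt with rfl | hc'
        · intro q' _
          simp [minVertices, vertexValue]
        · rw [minVertices_smul hc', huc, minVertices_smul hc, minVertices_baryGrad hs q hd]
      · intro hw
        obtain ⟨t, ht⟩ := exists_minimal_vertex (s := s) w
        have h1 := sum_slack_smul_baryGrad hs w fun j => vertexValue s w ⟨j, t j⟩
        rw [Finset.sum_eq_single q] at h1
        · refine ⟨(vertexValue s w q - vertexValue s w ⟨q.1, t q.1⟩) * c⁻¹, ?_, ?_⟩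
          · have := ht q.1 q.2
            exact mul_nonneg (sub_nonneg.2 this) (by positivity)
          · rw [huc, smul_smul, inv_mul_cancel_right₀ hc.ne', ← h1]
        · intro q' _ hq'
          have h2 := hw (show q' ∈ ({q}ᶜ : Set _) from hq') (t q'.1)
          have h3 := ht q'.1 q'.2
          rw [le_antisymm h2 h3, sub_self, zero_smul]
        · simp

theorem exists_primitive_eq_smul_baryGrad
    (hs : ∀ j, AffineIndependent ℝ fun l => toReal (s j l))
    (q : Σ j, Fin (d j + 1)) (hq : 0 < d q.1) :
    ∃ (u : (Σ j, Fin (d j)) → ℤ) (c : ℝ), Finset.univ.gcd u = 1 ∧ 0 < c ∧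
      toReal u = c • baryGrad hs q := by
  obtain ⟨W, C, hC, hW⟩ := exists_toReal_eq_smul_baryGrad hs q
  obtain ⟨u, hu, hgcd⟩ := Finset.extract_gcd (s := Finset.univ) W
    ⟨⟨q.1, ⟨0, hq⟩⟩, Finset.mem_univ _⟩
  have hne : Finset.univ.gcd W ≠ 0 := by
    intro h0
    have h1 := Finset.gcd_eq_zero_iff.1 h0
    have h2 : toReal W = 0 := funext fun x => by simp [toReal, h1 x (Finset.mem_univ x)]
    rw [hW, smul_eq_zero] at h2
    exact h2.elim hC.ne' (baryGrad_ne_zero hs q hq)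
  have hpos : (0 : ℝ) < (Finset.univ.gcd W : ℤ) := by
    have h1 : 0 ≤ Finset.univ.gcd W := by
      rw [← Finset.normalize_gcd, ← Int.abs_eq_normalize]
      exact abs_nonneg _
    exact_mod_cast lt_of_le_of_ne h1 hne.symm
  refine ⟨u, ((Finset.univ.gcd W : ℤ) : ℝ)⁻¹ * C, hgcd, by positivity, ?_⟩
  rw [mul_smul, ← hW]
  ext x
  simp only [toReal, Pi.smul_apply, smul_eq_mul]
  rw [hu x (Finset.mem_univ x)]
  push_cast
  rw [inv_mul_cancel_left₀ hpos.ne']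

theorem primitive_unique {ι : Type*} [Fintype ι] {u u' : ι → ℤ} (hu : Finset.univ.gcd u = 1)
    (hu' : Finset.univ.gcd u' = 1) {c : ℝ} (hc : 0 < c) (h : toReal u = c • toReal u') :
    u = u' := by
  obtain ⟨m, hm⟩ : ∃ m, u' m ≠ 0 := by
    by_contra hcon
    push Not at hcon
    rw [Finset.gcd_eq_zero_iff.2 fun x _ => hcon x] at hu'
    exact zero_ne_one hu'
  have hx : ∀ x, (u x : ℝ) = c * u' x := fun x => congrFun h x
  have h1 : ∀ x, u' m * u x = u m * u' x := by
    intro x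
    have : (u' m : ℝ) * u x = u m * u' x := by
      rw [hx x, hx m]
      ring
    exact_mod_cast this
  -- Taking gcds of the proportional vectors, both primitive, leaves |u'_m| = |u_m|, which forces c
  -- = 1.
  have h2 : (Finset.univ.gcd fun x => u' m * u x) = Finset.univ.gcd fun x => u m * u' x := by
    simp only [h1]
  rw [Finset.gcd_mul_left, Finset.gcd_mul_left, hu, hu', mul_one, mul_one, ← Int.abs_eq_normalize,
    ← Int.abs_eq_normalize] at h2
  have h3 : |(u' m : ℝ)| = |(u m : ℝ)| := by exact_mod_cast h2
  rw [hx m, abs_mul, abs_of_pos hc] at h3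
  have h4 : |(u' m : ℝ)| ≠ 0 := by simpa using hm
  have h5 : c = 1 := by
    field_simp at h3
    linarith
  ext x
  have := hx x
  rw [h5, one_mul] at this
  exact_mod_cast this

end Rays

/-! ### Heights over the facets and lattice volumes. -/

section FacetVolume

variable {k : ℕ} {d : Fin k → ℕ} {s : ∀ j, Fin (d j + 1) → Fin (d j) → ℤ}

theorem mem_simplexProduct_of_mem {A : Finset ((Σ j, Fin (d j)) → ℤ)}
    (hA : polytope A = simplexProduct s) {a : (Σ j, Fin (d j)) → ℤ} (ha : a ∈ A) :
    toReal a ∈ simplexProduct s := by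
  rw [← hA]
  exact subset_convexHull _ _ ⟨a, ha, rfl⟩

theorem toReal_injective {κ : Type*} : Function.Injective (toReal (κ := κ)) := by
  intro a b h
  ext x
  have := congrFun h x
  simpa [toReal] using this

theorem eq_of_baryCoord_eq (hs : ∀ j, AffineIndependent ℝ fun l => toReal (s j l))
    {p p' : (Σ j, Fin (d j)) → ℝ} (h : ∀ q, baryCoord hs q p = baryCoord hs q p') : p = p' := by
  ext x
  rw [← sum_baryCoord_mul hs p x, ← sum_baryCoord_mul hs p' x]
  simp only [h]

/-- The vertices of a lattice polytope belong to every set of lattice points spanning it. -/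
theorem prodVertex_mem (hs : ∀ j, AffineIndependent ℝ fun l => toReal (s j l))
    {A : Finset ((Σ j, Fin (d j)) → ℤ)} (hA : polytope A = simplexProduct s)
    (w : ∀ j, Fin (d j + 1)) : prodVertex s w ∈ A := by
  -- On the polytope `φ` is at most k, with equality only at the vertex `w`. If that vertex were not
  -- in `A`, then `φ` would be less than k on `A` and so on its convex hull.
  let φ : ((Σ j, Fin (d j)) → ℝ) →ᵃ[ℝ] ℝ := ∑ j, baryCoord hs ⟨j, w j⟩
  have hφ : ∀ p, φ p = ∑ j, baryCoord hs ⟨j, w j⟩ p := by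
    intro p
    simp only [φ]
    induction (Finset.univ : Finset (Fin k)) using Finset.induction_on with
    | empty => simp
    | insert j S hj ih => simp [Finset.sum_insert hj, ih]
  by_contra hw
  have hlt : ∀ a ∈ A, φ (toReal a) < k := by
    intro a ha
    by_contra hcon
    rw [not_lt, hφ] at hcon
    have hnn := (mem_simplexProduct_iff hs _).1 (mem_simplexProduct_of_mem hA ha)
    have hle : ∀ q, baryCoord hs q (toReal a) ≤ 1 := by
      rintro ⟨j, l⟩
      rw [← sum_baryCoord hs j (toReal a)]
      exact Finset.single_le_sum (f := fun l => baryCoord hs ⟨j, l⟩ (toReal a))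
        (fun l _ => hnn ⟨j, l⟩) (Finset.mem_univ l)
    have hone : ∀ j, baryCoord hs ⟨j, w j⟩ (toReal a) = 1 := by
      intro j
      have h1 : ∑ j, (1 - baryCoord hs ⟨j, w j⟩ (toReal a)) ≤ 0 := by
        rw [Finset.sum_sub_distrib]
        simpa using hcon
      have h2 := Finset.single_le_sum (f := fun j => 1 - baryCoord hs ⟨j, w j⟩ (toReal a))
        (fun j _ => sub_nonneg.2 (hle ⟨j, w j⟩)) (Finset.mem_univ j)
      have h3 := hle ⟨j, w j⟩
      linarith
    refine hw ?_
    have : toReal a = toReal (prodVertex s w) := by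
      refine eq_of_baryCoord_eq hs fun q => ?_
      obtain ⟨j, l⟩ := q
      rw [baryCoord_vertex]
      split_ifs with hl
      · dsimp only at hl
        rw [← hl]
        exact hone j
      · have h1 := sum_baryCoord hs j (toReal a)
        have h2 := Finset.add_le_sum (f := fun l => baryCoord hs ⟨j, l⟩ (toReal a))
          (fun l _ => hnn ⟨j, l⟩) (Finset.mem_univ (w j)) (Finset.mem_univ l) hl
        have h3 := hnn ⟨j, l⟩
        have h4 := hone j
        linarith
    rwa [← toReal_injective this]
  have hsub : polytope A ⊆ {p | φ p < k} := by
    refine convexHull_min ?_ ?_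
    · rintro _ ⟨a, ha, rfl⟩
      exact hlt a ha
    · exact (convex_Iio (k : ℝ)).affine_preimage φ
  have h1 := hsub (hA ▸ vertex_mem_simplexProduct w)
  rw [Set.mem_ofPred_eq, hφ] at h1
  simp [baryCoord_vertex] at h1

theorem mem_oppositeFacet_iff (hs : ∀ j, AffineIndependent ℝ fun l => toReal (s j l))
    (j : Fin k) (l : Fin (d j + 1)) (p : (Σ j, Fin (d j)) → ℝ) :
    p ∈ oppositeFacet s j l ↔ p ∈ simplexProduct s ∧ baryCoord hs ⟨j, l⟩ p = 0 := by
  refine and_congr_right fun hp => ⟨fun h => ?_, fun h => ?_⟩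
  · have hsub : convexHull ℝ ((fun l' => toReal (s j l')) '' {l' | l' ≠ l}) ⊆
        (simplexBasis hs j).coord l ⁻¹' {0} := by
      refine convexHull_min ?_ ((convex_singleton (0 : ℝ)).affine_preimage _)
      rintro _ ⟨l', hl', rfl⟩
      exact (simplexBasis hs j).coord_apply_ne (Ne.symm hl')
    exact hsub h
  · have hsum := (simplexBasis hs j).linear_combination_coord_eq_self fun m => p ⟨j, m⟩
    have hnn := (mem_simplexProduct_iff hs p).1 hp
    have hone := sum_baryCoord hs j p
    rw [← Finset.sum_erase_add _ _ (Finset.mem_univ l), h, add_zero] at hone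
    rw [← Finset.sum_erase_add _ _ (Finset.mem_univ l)] at hsum
    have h0 : (simplexBasis hs j).coord l (fun m => p ⟨j, m⟩) = 0 := h
    rw [h0, zero_smul, add_zero] at hsum
    rw [← hsum]
    refine (convex_convexHull ℝ _).sum_mem (fun l' _ => hnn ⟨j, l'⟩) hone fun l' hl' => ?_
    exact subset_convexHull _ _ ⟨l', Finset.ne_of_mem_erase hl', rfl⟩

theorem face_smul_baryGrad_eq_oppositeFacet_iff
    (hs : ∀ j, AffineIndependent ℝ fun l => toReal (s j l))
    (q : Σ j, Fin (d j + 1)) (hq : 0 < d q.1) {c : ℝ} (hc : 0 < c)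
    (j : Fin k) (l : Fin (d j + 1)) :
    face (simplexProduct s) (c • baryGrad hs q) = oppositeFacet s j l ↔ q = ⟨j, l⟩ := by
  have hface : ∀ p, p ∈ face (simplexProduct s) (c • baryGrad hs q) ↔
      p ∈ simplexProduct s ∧ baryCoord hs q p = 0 := by
    intro p
    rw [mem_face_iff hs, minVertices_smul hc, minVertices_baryGrad hs q hq]
    refine and_congr_right fun _ => ⟨fun h => ?_, fun h q' hq' => ?_⟩
    · by_contra h0
      exact h q h0 rfl
    · rintro rfl
      exact hq' h
  constructor
  · intro h
    obtain ⟨l', hl'⟩ := exists_ne_of_pos hq q.2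
    -- This vertex lies on the facet of q but uses `s j l`, so it separates the two facets. The
    -- update at `j` is outermost because `j` may be the block of q.
    let w : ∀ j, Fin (d j + 1) := Function.update (Function.update 0 q.1 l') j l
    by_contra hne
    have h1 : toReal (prodVertex s w) ∈ face (simplexProduct s) (c • baryGrad hs q) := by
      refine (hface _).2 ⟨vertex_mem_simplexProduct w, ?_⟩
      rw [baryCoord_vertex, if_neg]
      obtain ⟨j', l''⟩ := q
      by_cases hj : j' = j
      · subst hj
        simp only [w, Function.update_self]
        rintro rfl
        exact hne rfl
      · simpa [w, hj] using hl'
    rw [h, mem_oppositeFacet_iff hs, baryCoord_vertex] at h1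
    simp [w] at h1
  · rintro rfl
    ext p
    rw [hface, mem_oppositeFacet_iff hs]

theorem toReal_dotProduct {ι : Type*} [Fintype ι] (u a : ι → ℤ) :
    ((u ⬝ᵥ a : ℤ) : ℝ) = toReal u ⬝ᵥ toReal a := by
  simp [dotProduct, toReal]

/-- The minimum of `u` over `A` is attained at a vertex where λ_q vanishes; such a vertex belongs to
`A` by `prodVertex_mem`. -/
theorem cast_dotProduct_add_supportConst (hs : ∀ j, AffineIndependent ℝ fun l => toReal (s j l))
    {A : Finset ((Σ j, Fin (d j)) → ℤ)} (hA : polytope A = simplexProduct s)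
    {u : (Σ j, Fin (d j)) → ℤ} {q : Σ j, Fin (d j + 1)} (hq : 0 < d q.1) {c : ℝ} (hc : 0 < c)
    (hu : toReal u = c • baryGrad hs q) (a : (Σ j, Fin (d j)) → ℤ) :
    ((u ⬝ᵥ a + supportConst A u : ℤ) : ℝ) = c * baryCoord hs q (toReal a) := by
  have hdiff : ∀ a a' : (Σ j, Fin (d j)) → ℤ, ((u ⬝ᵥ a : ℤ) : ℝ) - ((u ⬝ᵥ a' : ℤ) : ℝ) =
      c * (baryCoord hs q (toReal a) - baryCoord hs q (toReal a')) := by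
    intro a a'
    rw [toReal_dotProduct, toReal_dotProduct, hu, ← baryGrad_dotProduct_sub, smul_dotProduct,
      smul_dotProduct, smul_eq_mul, smul_eq_mul, mul_sub]
  obtain ⟨l', hl'⟩ := exists_ne_of_pos hq q.2
  have h0 : baryCoord hs q (toReal (prodVertex s (Function.update 0 q.1 l'))) = 0 := by
    rw [baryCoord_vertex, Function.update_self, if_neg hl']
  have hleast : IsLeast ((fun a => u ⬝ᵥ a) '' (A : Set ((Σ j, Fin (d j)) → ℤ)))
      (u ⬝ᵥ prodVertex s (Function.update 0 q.1 l')) := by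
    refine ⟨⟨_, prodVertex_mem hs hA _, rfl⟩, ?_⟩
    rintro _ ⟨a', ha', rfl⟩
    have h1 := hdiff a' (prodVertex s (Function.update 0 q.1 l'))
    rw [h0, sub_zero] at h1
    have h2 := mul_nonneg hc.le
      ((mem_simplexProduct_iff hs _).1 (mem_simplexProduct_of_mem hA ha') q)
    rw [← h1, sub_nonneg] at h2
    exact_mod_cast h2
  rw [supportConst, hleast.csInf_eq, ← sub_eq_add_neg, Int.cast_sub, hdiff, h0, sub_zero]

theorem cast_height (hs : ∀ j, AffineIndependent ℝ fun l => toReal (s j l))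
    {A : Finset ((Σ j, Fin (d j)) → ℤ)} (hA : polytope A = simplexProduct s)
    {u : (Σ j, Fin (d j)) → ℤ} {q : Σ j, Fin (d j + 1)} (hq : 0 < d q.1) {c : ℝ} (hc : 0 < c)
    (hu : toReal u = c • baryGrad hs q) :
    (((∑ m, u ⟨q.1, m⟩ * s q.1 q.2 m) + supportConst A u : ℤ) : ℝ) = c := by
  have h0 : ∀ x : Σ j, Fin (d j), x.1 ≠ q.1 → u x = 0 := by
    intro x hx
    have := congrFun hu x
    rw [Pi.smul_apply, baryGrad_apply_of_ne hs q x hx, smul_zero] at this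
    simpa [toReal] using this
  have h1 := cast_dotProduct_add_supportConst hs hA hq hc hu
    (prodVertex s (Function.update 0 q.1 q.2))
  rw [baryCoord_vertex, Function.update_self, if_pos rfl, mul_one] at h1
  rw [← h1]
  congr 2
  rw [dotProduct, Fintype.sum_sigma, Finset.sum_eq_single q.1]
  · simp [prodVertex]
  · intro j _ hj
    exact Finset.sum_eq_zero fun m _ => by rw [h0 ⟨j, m⟩ hj, zero_mul]
  · simp

/-- Multiplying uᵀM = h zᵀ by the adjugate shows that h divides every entry of det M · u; as `u` is
primitive, h divides det M. This makes the division in `facetVolume` exact. -/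
theorem height_dvd_det (hs : ∀ j, AffineIndependent ℝ fun l => toReal (s j l))
    {u : (Σ j, Fin (d j)) → ℤ} (hgcd : Finset.univ.gcd u = 1) {q : Σ j, Fin (d j + 1)} {c : ℝ}
    (hu : toReal u = c • baryGrad hs q) {h : ℤ} (hh : (h : ℝ) = c) :
    h ∣ (edgeMatrix (s q.1)).det := by
  classical
  let z : Fin (d q.1) → ℤ := fun l =>
    (if q = ⟨q.1, l.castSucc⟩ then 1 else 0) - if q = ⟨q.1, Fin.last _⟩ then 1 else 0
  have hz : Matrix.vecMul (fun m => u ⟨q.1, m⟩) (edgeMatrix (s q.1)) = h • z := by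
    ext l
    have h1 := vertexValue_edge (s := s) u q.1 l
    rw [hu, vertexValue_smul, vertexValue_smul, ← mul_sub, vertexValue_baryGrad_sub, ← hh] at h1
    have h2 : (((h • z) l : ℤ) : ℝ) =
        ((Matrix.vecMul (fun m => u ⟨q.1, m⟩) (edgeMatrix (s q.1)) l : ℤ) : ℝ) := by
      rw [← h1]
      simp only [z, Pi.smul_apply, smul_eq_mul]
      push_cast
      rfl
    exact_mod_cast h2.symm
  have hdet : ∀ m, (edgeMatrix (s q.1)).det * u ⟨q.1, m⟩ =
      h * Matrix.vecMul z (edgeMatrix (s q.1)).adjugate m := by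
    intro m
    have h1 := congrArg (fun y => Matrix.vecMul y (edgeMatrix (s q.1)).adjugate m) hz
    simp only [Matrix.vecMul_vecMul, Matrix.mul_adjugate, Matrix.vecMul_smul, Matrix.smul_vecMul,
      Matrix.vecMul_one, Pi.smul_apply, smul_eq_mul] at h1
    exact h1
  have hdvd : h ∣ Finset.univ.gcd fun x => (edgeMatrix (s q.1)).det * u x := by
    refine Finset.dvd_gcd ?_
    rintro ⟨j, m⟩ _
    by_cases hj : j = q.1
    · subst hj
      rw [hdet]
      exact dvd_mul_right _ _
    · have := congrFun hu ⟨j, m⟩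
      rw [Pi.smul_apply, baryGrad_apply_of_ne hs q ⟨j, m⟩ hj, smul_zero] at this
      have h0 : u ⟨j, m⟩ = 0 := by simpa [toReal] using this
      simp [h0]
  rw [Finset.gcd_mul_left, hgcd, mul_one] at hdvd
  exact dvd_normalize_iff.1 hdvd

theorem facetVolume_mul_eq (hs : ∀ j, AffineIndependent ℝ fun l => toReal (s j l))
    {A : Finset ((Σ j, Fin (d j)) → ℤ)} (hA : polytope A = simplexProduct s)
    {u : (Σ j, Fin (d j)) → ℤ} (hgcd : Finset.univ.gcd u = 1)
    {q : Σ j, Fin (d j + 1)} (hq : 0 < d q.1) {c : ℝ} (hc : 0 < c)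
    (hu : toReal u = c • baryGrad hs q) :
    (facetVolume s A u : ℝ) * c = (edgeMatrix (s q.1)).det.natAbs := by
  classical
  have hval : facetVolume s A u = (edgeMatrix (s q.1)).det.natAbs /
      ((∑ m, u ⟨q.1, m⟩ * s q.1 q.2 m) + supportConst A u).natAbs := by
    unfold facetVolume
    simp only [hA, hu, face_smul_baryGrad_eq_oppositeFacet_iff hs q hq hc]
    rw [Finset.sum_eq_single q.1, Finset.sum_eq_single q.2]
    · simp
    · intro l _ hl
      rw [if_neg]
      intro h
      refine hl ?_
      rw [Sigma.ext_iff] at h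
      exact (eq_of_heq h.2).symm
    · simp
    · intro j _ hj
      refine Finset.sum_eq_zero fun l _ => ?_
      rw [if_neg]
      rintro rfl
      exact hj rfl
    · simp
  have hh := cast_height hs hA hq hc hu
  have hdvd := height_dvd_det hs hgcd hu hh
  have hpos : 0 < (∑ m, u ⟨q.1, m⟩ * s q.1 q.2 m) + supportConst A u := by
    have : (0 : ℝ) < (((∑ m, u ⟨q.1, m⟩ * s q.1 q.2 m) + supportConst A u : ℤ) : ℝ) := by
      rw [hh]
      exact hc
    exact_mod_cast this
  have hc' : c = (((∑ m, u ⟨q.1, m⟩ * s q.1 q.2 m) + supportConst A u).natAbs : ℝ) := by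
    rw [← hh, Nat.cast_natAbs, abs_of_pos hpos]
  rw [hc', hval, ← Nat.cast_mul, Nat.div_mul_cancel (Int.natAbs_dvd_natAbs.2 hdvd)]

end FacetVolume

/-! ### The dictionary between rays and barycentric coordinates. -/

section RayIndex

variable {k : ℕ} {d : Fin k → ℕ} {s : ∀ j, Fin (d j + 1) → Fin (d j) → ℤ}

/-- The data relating the rays of the normal fan of a product of simplices to the barycentric
coordinates: the `i`-th ray is normal to the facet on which the coordinate `ρ i` vanishes. -/
structure IsRayIndex (hs : ∀ j, AffineIndependent ℝ fun l => toReal (s j l))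
    (A : Finset ((Σ j, Fin (d j)) → ℤ)) {r : ℕ} (F : Fin r → (Σ j, Fin (d j)) → ℤ)
    (v : Fin r → ℕ) (ρ : Fin r → Σ j, Fin (d j + 1)) : Prop where
  injective : Function.Injective ρ
  mem_range_iff : ∀ q, q ∈ Set.range ρ ↔ 0 < d q.1
  mem_vertexCone_iff : ∀ i T, toReal (F i) ∈ vertexCone s T ↔ ρ i ∉ T
  mul_height : ∀ i a, ((v i * (F i ⬝ᵥ a + supportConst A (F i)) : ℤ) : ℝ) =
    (edgeMatrix (s (ρ i).1)).det.natAbs * baryCoord hs (ρ i) (toReal a)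
  height_nonneg : ∀ i, ∀ a ∈ A, 0 ≤ F i ⬝ᵥ a + supportConst A (F i)

theorem exists_isRayIndex (hs : ∀ j, AffineIndependent ℝ fun l => toReal (s j l))
    {A : Finset ((Σ j, Fin (d j)) → ℤ)} (hA : polytope A = simplexProduct s)
    {r : ℕ} {F : Fin r → (Σ j, Fin (d j)) → ℤ} (hF_inj : Function.Injective F)
    (hF_range : Set.range F = {u | IsRayGenerator (polytope A) u})
    {v : Fin r → ℕ} (hv : ∀ i, v i = facetVolume s A (F i)) :
    ∃ ρ, IsRayIndex hs A F v ρ := by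
  have hF : ∀ i, Finset.univ.gcd (F i) = 1 ∧
      ∃ (q : Σ j, Fin (d j + 1)) (c : ℝ), 0 < d q.1 ∧ 0 < c ∧
        toReal (F i) = c • baryGrad hs q := by
    intro i
    rw [← isRayGenerator_iff, ← hA]
    exact hF_range.subset ⟨i, rfl⟩
  choose hgcd ρ c hd hc hFc using hF
  have hray := fun i a => cast_dotProduct_add_supportConst hs hA (hd i) (hc i) (hFc i) a
  refine ⟨ρ, ?_, ?_, ?_, ?_, ?_⟩
  · intro i i' h
    refine hF_inj (primitive_unique (hgcd i) (hgcd i') (c := c i * (c i')⁻¹)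
      (mul_pos (hc i) (inv_pos.2 (hc i'))) ?_)
    rw [hFc i', smul_smul, inv_mul_cancel_right₀ (hc i').ne', hFc i, h]
  · intro q
    constructor
    · rintro ⟨i, rfl⟩
      exact hd i
    · intro hq
      obtain ⟨u, C, hu, hC, huC⟩ := exists_primitive_eq_smul_baryGrad hs q hq
      have : u ∈ Set.range F := by
        rw [hF_range, hA]
        exact (isRayGenerator_iff hs u).2 ⟨hu, q, C, hq, hC, huC⟩
      obtain ⟨i, rfl⟩ := this
      refine ⟨i, ?_⟩
      have h1 := hFc i
      have h2 := congrArg (minVertices s) (h1.symm.trans huC)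
      rw [minVertices_smul (hc i), minVertices_smul hC, minVertices_baryGrad hs _ (hd i),
        minVertices_baryGrad hs _ hq, compl_inj_iff, Set.singleton_eq_singleton_iff] at h2
      exact h2
  · intro i T
    change T ⊆ minVertices s _ ↔ _
    rw [hFc i, minVertices_smul (hc i), minVertices_baryGrad hs _ (hd i),
      Set.subset_compl_singleton_iff]
  · intro i a
    rw [Int.cast_mul, hray, hv i, ← facetVolume_mul_eq hs hA (hgcd i) (hd i) (hc i) (hFc i)]
    push_cast
    ring
  · intro i a ha
    have h1 := mul_nonneg (hc i).le
      ((mem_simplexProduct_iff hs _).1 (mem_simplexProduct_of_mem hA ha) (ρ i))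
    rw [← hray] at h1
    exact_mod_cast h1

end RayIndex

/-! ### Primitive collections and the irrelevant sum. -/

section Combinatorics

variable {k : ℕ} {d : Fin k → ℕ} {s : ∀ j, Fin (d j + 1) → Fin (d j) → ℤ}
  {hs : ∀ j, AffineIndependent ℝ fun l => toReal (s j l)}
  {A : Finset ((Σ j, Fin (d j)) → ℤ)} {r : ℕ} {F : Fin r → (Σ j, Fin (d j)) → ℤ}
  {v : Fin r → ℕ} {ρ : Fin r → Σ j, Fin (d j + 1)}

/-- The simplex of positive dimension to which a ray belongs. -/
def IsRayIndex.block (hρ : IsRayIndex hs A F v ρ) (i : Fin r) : {j // 0 < d j} :=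
  ⟨(ρ i).1, (hρ.mem_range_iff _).1 ⟨i, rfl⟩⟩

theorem IsRayIndex.block_eq_iff (hρ : IsRayIndex hs A F v ρ) (i : Fin r) (j : {j // 0 < d j}) :
    hρ.block i = j ↔ (ρ i).1 = j :=
  Subtype.ext_iff

theorem IsRayIndex.exists_eq (hρ : IsRayIndex hs A F v ρ) {j : Fin k} (hj : 0 < d j)
    (l : Fin (d j + 1)) : ∃ i, ρ i = ⟨j, l⟩ :=
  (hρ.mem_range_iff ⟨j, l⟩).2 hj

theorem IsRayIndex.sum_block {M : Type*} [AddCommMonoid M] (hρ : IsRayIndex hs A F v ρ)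
    (j : {j // 0 < d j}) (G : (Σ j, Fin (d j + 1)) → M) :
    ∑ i with hρ.block i = j, G (ρ i) = ∑ l, G ⟨j, l⟩ := by
  choose g hg using hρ.exists_eq j.2
  symm
  refine Finset.sum_bij (fun l _ => g l) (fun l _ => ?_) (fun l _ l' _ h => ?_) (fun i hi => ?_)
    (fun l _ => by rw [hg])
  · simp [hρ.block_eq_iff, hg]
  · have h1 := hg l
    rw [h, hg l'] at h1
    exact (eq_of_heq (Sigma.ext_iff.1 h1).2).symm
  · obtain rfl := (Finset.mem_filter.1 hi).2
    exact ⟨(ρ i).2, Finset.mem_univ _, hρ.injective (hg (ρ i).2)⟩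

theorem IsRayIndex.sum_comp {M : Type*} [AddCommMonoid M] (hρ : IsRayIndex hs A F v ρ)
    (G : (Σ j, Fin (d j + 1)) → M) (hG : ∀ q, d q.1 = 0 → G q = 0) :
    ∑ i, G (ρ i) = ∑ q, G q := by
  refine Fintype.sum_of_injective ρ hρ.injective _ _ (fun q hq => hG q ?_) fun i => rfl
  rw [hρ.mem_range_iff] at hq
  omega

/-- A cone is given by vertices meeting every block and contains the rays opposite to none of them.
So rays share a cone unless they exhaust a block; the minimal failures are the full blocks. -/
theorem IsRayIndex.exists_cone_iff (hρ : IsRayIndex hs A F v ρ)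
    (hA : polytope A = simplexProduct s) (C : Finset (Fin r)) :
    (∃ σ ∈ normalFan (polytope A), ∀ i ∈ C, toReal (F i) ∈ σ) ↔
      ∀ j, ∃ l, ∀ i ∈ C, ρ i ≠ ⟨j, l⟩ := by
  rw [hA]
  constructor
  · rintro ⟨σ, hσ, hC⟩ j
    obtain ⟨T, hT, rfl⟩ := (mem_normalFan_iff hs σ).1 hσ
    obtain ⟨l, hl⟩ := hT j
    refine ⟨l, fun i hi h => ?_⟩
    exact (hρ.mem_vertexCone_iff i T).1 (hC i hi) (h ▸ hl)
  · intro h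
    refine ⟨vertexCone s {q | ∀ i ∈ C, ρ i ≠ q},
      (mem_normalFan_iff hs _).2 ⟨{q | ∀ i ∈ C, ρ i ≠ q}, h, rfl⟩, fun i hi => ?_⟩
    rw [hρ.mem_vertexCone_iff]
    exact fun hcon => hcon i hi rfl

theorem IsRayIndex.mem_primitiveCollections_iff (hρ : IsRayIndex hs A F v ρ)
    (hA : polytope A = simplexProduct s) (C : Finset (Fin r)) :
    C ∈ primitiveCollections A F ↔ ∃ j, C = Finset.univ.filter fun i => hρ.block i = j := by
  have hblock : ∀ j : {j // 0 < d j}, ¬ ∃ σ ∈ normalFan (polytope A),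
      ∀ i ∈ Finset.univ.filter fun i => hρ.block i = j, toReal (F i) ∈ σ := by
    intro j
    rw [hρ.exists_cone_iff hA]
    intro h
    obtain ⟨l, hl⟩ := h j
    obtain ⟨i, hi⟩ := hρ.exists_eq j.2 l
    exact hl i (by simp [hρ.block_eq_iff, hi]) hi
  rw [primitiveCollections]
  simp only [Finset.mem_filter_univ]
  constructor
  · rintro ⟨h1, h2⟩
    rw [hρ.exists_cone_iff hA] at h1
    push Not at h1
    obtain ⟨j, hj⟩ := h1
    have hd : 0 < d j := by
      obtain ⟨i, -, hi⟩ := hj 0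
      exact (hρ.mem_range_iff ⟨j, 0⟩).1 ⟨i, hi⟩
    refine ⟨⟨j, hd⟩, ?_⟩
    have hsub : (Finset.univ.filter fun i => hρ.block i = ⟨j, hd⟩) ⊆ C := by
      intro i hi
      have hi' := (Finset.mem_filter.1 hi).2
      rw [hρ.block_eq_iff] at hi'
      dsimp only at hi'
      subst hi'
      obtain ⟨i', hi'C, hi'⟩ := hj (ρ i).2
      rwa [← hρ.injective hi']
    by_contra hne
    exact hblock _ (h2 _ (Finset.ssubset_iff_subset_ne.2 ⟨hsub, Ne.symm hne⟩))
  · rintro ⟨j, rfl⟩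
    refine ⟨by simpa using hblock j, fun D hD => ?_⟩
    rw [hρ.exists_cone_iff hA]
    obtain ⟨i₀, hi₀, hi₀D⟩ := Finset.exists_of_ssubset hD
    intro j'
    by_cases hj : j' = (ρ i₀).1
    · subst hj
      refine ⟨(ρ i₀).2, fun i hi h => hi₀D ?_⟩
      rwa [← hρ.injective h]
    · refine ⟨0, fun i hi h => hj ?_⟩
      have h1 := (Finset.mem_filter.1 (hD.1 hi)).2
      have h2 := (Finset.mem_filter.1 hi₀).2
      rw [hρ.block_eq_iff] at h1 h2
      rw [h2, ← h1, h]

theorem IsRayIndex.prod_primitiveCollections (hρ : IsRayIndex hs A F v ρ)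
    (hA : polytope A = simplexProduct s) (N : ℕ) :
    ∏ C ∈ primitiveCollections A F, (∑ i ∈ C, X i : MvPolynomial (Fin r) ℝ) ^ N =
      (∏ j, blockSum hρ.block j) ^ N := by
  classical
  have himage : primitiveCollections A F =
      Finset.univ.image fun j => Finset.univ.filter fun i => hρ.block i = j := by
    ext C
    rw [hρ.mem_primitiveCollections_iff hA]
    simp [eq_comm]
  rw [himage, Finset.prod_image, Finset.prod_pow]
  · rfl
  · intro j _ j' _ h
    obtain ⟨i, hi⟩ := hρ.exists_eq j.2 0
    have h1 : i ∈ Finset.univ.filter fun i => hρ.block i = j := by simp [hρ.block_eq_iff, hi]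
    dsimp only at h
    rw [h] at h1
    have h2 := (Finset.mem_filter.1 h1).2
    rw [hρ.block_eq_iff, hi] at h2
    exact Subtype.ext h2

theorem coneDim_vertexCone_section (hs : ∀ j, AffineIndependent ℝ fun l => toReal (s j l))
    (w : ∀ j, Fin (d j + 1)) :
    coneDim (vertexCone s {q | w q.1 = q.2}) = Fintype.card (Σ j, Fin (d j)) := by
  have htop : Submodule.span ℝ (vertexCone s {q | w q.1 = q.2}) = ⊤ := by
    rw [eq_top_iff]
    intro x _
    rw [sum_slack_smul_baryGrad hs x fun j => vertexValue s x ⟨j, w j⟩]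
    refine Submodule.sum_mem _ fun q _ => ?_
    by_cases hq : w q.1 = q.2
    · rw [hq, sub_self, zero_smul]
      exact Submodule.zero_mem _
    · refine Submodule.smul_mem _ _ (Submodule.subset_span ?_)
      have hd : 0 < d q.1 := by
        rw [Nat.pos_iff_ne_zero]
        intro hd
        exact hq (Fin.ext (by omega))
      change _ ⊆ minVertices s _
      rw [minVertices_baryGrad hs q hd, Set.subset_compl_singleton_iff]
      exact hq
  rw [coneDim, htop, finrank_top, Module.finrank_fintype_fun_eq_card]

/-- Two vertices of `T` in one block would confine the cone to the proper subspace of functionals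
with equal values at both. -/
theorem eq_section_of_coneDim (hs : ∀ j, AffineIndependent ℝ fun l => toReal (s j l))
    {T : Set (Σ j, Fin (d j + 1))} {w : ∀ j, Fin (d j + 1)} (hw : ∀ j, ⟨j, w j⟩ ∈ T)
    (hT : coneDim (vertexCone s T) = Fintype.card (Σ j, Fin (d j))) :
    T = {q | w q.1 = q.2} := by
  refine Set.Subset.antisymm (fun q hq => ?_) ?_
  · by_contra hne
    let V : Submodule ℝ ((Σ j, Fin (d j)) → ℝ) :=
      { carrier := {x | vertexValue s x q = vertexValue s x ⟨q.1, w q.1⟩}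
        add_mem' := fun {x y} hx hy => by
          simp only [Set.mem_ofPred_eq, vertexValue_add] at hx hy ⊢
          rw [hx, hy]
        zero_mem' := by simp [vertexValue]
        smul_mem' := fun c x hx => by
          simp only [Set.mem_ofPred_eq, vertexValue_smul] at hx ⊢
          rw [hx] }
    have hle : Submodule.span ℝ (vertexCone s T) ≤ V := by
      refine Submodule.span_le.2 fun x hx => ?_
      exact le_antisymm (hx hq (w q.1)) (hx (hw q.1) q.2)
    have hV : V ≠ ⊤ := by
      intro h
      have h1 : baryGrad hs q ∈ V := h ▸ Submodule.mem_top
      have h2 : vertexValue s (baryGrad hs q) q =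
        vertexValue s (baryGrad hs q) ⟨q.1, w q.1⟩ := h1
      have h3 := vertexValue_baryGrad_sub hs q q.1 q.2 (w q.1)
      rw [h2, sub_self, if_pos rfl, if_neg] at h3
      · norm_num at h3
      · intro h
        exact hne (eq_of_heq (Sigma.ext_iff.1 h).2).symm
    have h1 := Submodule.finrank_mono hle
    have h2 := Submodule.finrank_lt hV
    rw [Module.finrank_fintype_fun_eq_card] at h2
    rw [coneDim] at hT
    omega
  · rintro ⟨j, l⟩ h
    have h' : w j = l := h
    exact h' ▸ hw j

/-- Maximal cones correspond to choices of one vertex per factor, and the rays outside such a cone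
are those opposite to the chosen vertices. The sum is therefore the expanded product of the block
sums. -/
theorem IsRayIndex.irrelevantSum_eq (hρ : IsRayIndex hs A F v ρ)
    (hA : polytope A = simplexProduct s) :
    irrelevantSum A F = ∏ j, blockSum hρ.block j := by
  classical
  have himage : maximalCones A =
      Finset.univ.image fun w : ∀ j, Fin (d j + 1) => vertexCone s {q | w q.1 = q.2} := by
    ext σ
    simp only [maximalCones, Finset.mem_filter, Set.Finite.mem_toFinset, Finset.mem_image,
      Finset.mem_univ, true_and, hA, mem_normalFan_iff hs]
    constructor
    · rintro ⟨⟨T, hT, rfl⟩, hdim⟩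
      choose w hw using hT
      exact ⟨w, by rw [eq_section_of_coneDim hs hw hdim]⟩
    · rintro ⟨w, rfl⟩
      exact ⟨⟨_, fun j => ⟨w j, rfl⟩, rfl⟩, coneDim_vertexCone_section hs w⟩
  have hinj : Function.Injective fun w : ∀ j, Fin (d j + 1) =>
      vertexCone s {q | w q.1 = q.2} := by
    intro w w' h
    funext j
    by_contra hne
    have hd : 0 < d j := by
      rw [Nat.pos_iff_ne_zero]
      intro hd
      exact hne (Fin.ext (by omega))
    obtain ⟨i, hi⟩ := hρ.exists_eq hd (w j)
    have h1 := hρ.mem_vertexCone_iff i {q | w q.1 = q.2}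
    have h2 := hρ.mem_vertexCone_iff i {q | w' q.1 = q.2}
    dsimp only at h
    rw [h, h2, hi] at h1
    simp [Ne.symm hne] at h1
  rw [irrelevantSum, himage, Finset.sum_image fun w _ w' _ h => hinj h]
  -- `Y q` is the variable of the ray belonging to q, or 1 if q lies in a factor of dimension zero,
  -- so that such factors drop out of the product.
  let Y : (Σ j, Fin (d j + 1)) → MvPolynomial (Fin r) ℝ := fun q => ∏ i with ρ i = q, X i
  have hterm : ∀ w : ∀ j, Fin (d j + 1),
      ∏ i with toReal (F i) ∉ vertexCone s {q | w q.1 = q.2}, (X i : MvPolynomial (Fin r) ℝ) =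
        ∏ j, Y ⟨j, w j⟩ := by
    intro w
    rw [← Finset.prod_fiberwise _ fun i => (ρ i).1]
    refine Finset.prod_congr rfl fun j _ => Finset.prod_congr ?_ fun _ _ => rfl
    ext i
    simp only [Finset.mem_filter, Finset.mem_univ, true_and, hρ.mem_vertexCone_iff, not_not,
      Set.mem_ofPred_eq]
    constructor
    · rintro ⟨h1, rfl⟩
      exact Sigma.ext rfl (heq_of_eq h1.symm)
    · intro h
      have h1 : (ρ i).1 = j := congrArg Sigma.fst h
      subst h1
      exact ⟨(eq_of_heq (Sigma.ext_iff.1 h).2).symm, rfl⟩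
  have hprod := Fintype.prod_sum fun (j : Fin k) l => Y ⟨j, l⟩
  rw [Finset.sum_congr (g := fun w : ∀ j, Fin (d j + 1) => ∏ j, Y ⟨j, w j⟩) rfl fun w _ => ?_,
    ← hprod, ← Fintype.prod_subtype_mul_prod_subtype fun j => 0 < d j]
  · have hone : ∏ j : {j // ¬ 0 < d j}, ∑ l, Y ⟨j, l⟩ = 1 := by
      refine Finset.prod_eq_one fun j _ => ?_
      have hd : d j = 0 := by have := j.2; omega
      have hY : ∀ l, Y ⟨j, l⟩ = 1 := by
        intro l
        have : (Finset.univ.filter fun i => ρ i = ⟨j, l⟩) = ∅ := by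
          refine Finset.filter_eq_empty_iff.2 fun i _ h => j.2 ?_
          exact (hρ.mem_range_iff ⟨j, l⟩).1 ⟨i, h⟩
        simp only [Y, this, Finset.prod_empty]
      simp [hY, hd]
    rw [hone, mul_one]
    refine Finset.prod_congr rfl fun j _ => ?_
    rw [← hρ.sum_block j Y, blockSum]
    refine Finset.sum_congr rfl fun i _ => ?_
    have : (Finset.univ.filter fun i' => ρ i' = ρ i) = {i} := by
      ext i'
      simp [hρ.injective.eq_iff]
    simp only [Y, this, Finset.prod_singleton]
  · rw [← hterm w]

end Combinatorics

/-! ### Points and binomial equations of the affine toric variety. -/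

section ToricVariety

variable {ι : Type*} [Fintype ι] {A : Finset (ι → ℤ)}

theorem aeval_eq_zero_of_mem_affineToricVariety {y : A → ℂ} (hy : y ∈ affineToricVariety A)
    {p : MvPolynomial A ℂ}
    (hp : ∀ (u : ℂ) (t : ι → ℂ), u ≠ 0 → (∀ x, t x ≠ 0) →
      aeval (fun a : A => u * ∏ x, t x ^ (a : ι → ℤ) x) p = 0) : aeval y p = 0 := by
  refine mem_zeroLocus_iff.1 hy p (mem_vanishingIdeal_iff.2 ?_)
  rintro z ⟨u, t, hu, ht, hz⟩
  rw [show z = fun a : A => u * ∏ x, t x ^ (a : ι → ℤ) x from funext hz]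
  exact hp u t hu ht

theorem prod_zpow_eq_zpow_sum {K I : Type*} [Field K] {z : K} (hz : z ≠ 0) (S : Finset I)
    (n : I → ℤ) : ∏ i ∈ S, z ^ n i = z ^ ∑ i ∈ S, n i := by
  classical
  induction S using Finset.induction_on with
  | empty => simp
  | insert i S hi ih => rw [Finset.prod_insert hi, Finset.sum_insert hi, zpow_add₀ hz, ih]

theorem prod_torus_pow {I : Type*} [Fintype I] (α : I → ι → ℤ) (n : I → ℕ) (u : ℂ) (t : ι → ℂ)
    (ht : ∀ x, t x ≠ 0) : ∏ i, (u * ∏ x, t x ^ α i x) ^ n i =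
      u ^ (∑ i, n i) * ∏ x, t x ^ ∑ i, n i * α i x := by
  simp only [mul_pow, Finset.prod_mul_distrib, Finset.prod_pow_eq_pow_sum, ← Finset.prod_pow]
  rw [Finset.prod_comm]
  congr 1
  refine Finset.prod_congr rfl fun x _ => ?_
  rw [← prod_zpow_eq_zpow_sum (ht x)]
  refine Finset.prod_congr rfl fun i _ => ?_
  rw [mul_comm, zpow_mul, zpow_natCast]

/-- The binomial equations satisfied by the points of an affine toric variety. -/
theorem binomial_of_mem_affineToricVariety {y : A → ℝ}
    (hy : (fun a => (y a : ℂ)) ∈ affineToricVariety A) {I I' : Type*} [Fintype I] [Fintype I']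
    (α : I → A) (n : I → ℕ) (α' : I' → A) (n' : I' → ℕ) (hdeg : ∑ i, n i = ∑ i, n' i)
    (hwt : ∀ x, ∑ i, (n i : ℤ) * (α i : ι → ℤ) x = ∑ i, (n' i : ℤ) * (α' i : ι → ℤ) x) :
    ∏ i, y (α i) ^ n i = ∏ i, y (α' i) ^ n' i := by
  have h := aeval_eq_zero_of_mem_affineToricVariety hy
    (p := ∏ i, X (α i) ^ n i - ∏ i, X (α' i) ^ n' i) fun u t _ ht => by
      simp only [map_sub, map_prod, map_pow, aeval_X]
      rw [prod_torus_pow (fun i => (α i : ι → ℤ)) n u t ht,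
        prod_torus_pow (fun i => (α' i : ι → ℤ)) n' u t ht, hdeg]
      simp only [hwt, sub_self]
  simp only [map_sub, map_prod, map_pow, aeval_X, sub_eq_zero] at h
  exact_mod_cast h

-- For positive `x` the vector is in the torus image, with u and t monomials in `x`. Boundary points
-- are reached by letting ε → 0 in x + ε, because polynomials are continuous.
open Filter Topology in
theorem monomial_mem_affineToricVariety {σ : Type*} [Fintype σ] (E : A → σ → ℕ) (G : σ → ι → ℤ)
    (b : σ → ℤ) (hE : ∀ a i, (E a i : ℤ) = G i ⬝ᵥ (a : ι → ℤ) + b i) (x : σ → ℝ)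
    (hx : ∀ i, 0 ≤ x i) :
    (fun a : A => ((∏ i, x i ^ E a i : ℝ) : ℂ)) ∈ affineToricVariety A := by
  refine mem_zeroLocus_iff.2 fun p hp => ?_
  have hpos : ∀ ε : ℝ, 0 < ε →
      aeval (fun a : A => ((∏ i, (x i + ε) ^ E a i : ℝ) : ℂ)) p = 0 := by
    intro ε hε
    have hne : ∀ i, ((x i + ε : ℝ) : ℂ) ≠ 0 := fun i => by
      have := hx i
      exact_mod_cast (by positivity : x i + ε ≠ 0)
    refine mem_vanishingIdeal_iff.1 hp _ ⟨∏ i, ((x i + ε : ℝ) : ℂ) ^ b i,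
      fun m => ∏ i, ((x i + ε : ℝ) : ℂ) ^ G i m, ?_, fun m => ?_, fun a => ?_⟩
    · exact Finset.prod_ne_zero_iff.2 fun i _ => zpow_ne_zero _ (hne i)
    · exact Finset.prod_ne_zero_iff.2 fun i _ => zpow_ne_zero _ (hne i)
    · simp only [← Finset.prod_zpow]
      rw [Finset.prod_comm, ← Finset.prod_mul_distrib, Complex.ofReal_prod]
      refine Finset.prod_congr rfl fun i _ => ?_
      simp only [← zpow_mul]
      rw [prod_zpow_eq_zpow_sum (hne i), ← zpow_add₀ (hne i), Complex.ofReal_pow,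
        ← zpow_natCast, hE, add_comm (b i)]
      rfl
  have hcont : Continuous fun ε : ℝ =>
      aeval (fun a : A => ((∏ i, (x i + ε) ^ E a i : ℝ) : ℂ)) p := by
    have h1 : Continuous fun z : A → ℂ => aeval z p := by
      simp only [aeval_eq_eval]
      exact continuous_eval p
    exact h1.comp (by fun_prop)
  have hlim := (hcont.tendsto 0).mono_left (nhdsWithin_le_nhds (s := Set.Ioi 0))
  have hzero := tendsto_nhds_unique hlim
    (tendsto_const_nhds.congr' (eventually_nhdsWithin_of_forall fun ε hε => (hpos ε hε).symm))
  simpa only [add_zero] using hzero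

end ToricVariety

/-! ### Cox coordinates of the nonnegative points. -/

section Parametrization

variable {k : ℕ} {d : Fin k → ℕ} {s : ∀ j, Fin (d j + 1) → Fin (d j) → ℤ}
  {hs : ∀ j, AffineIndependent ℝ fun l => toReal (s j l)}
  {A : Finset ((Σ j, Fin (d j)) → ℤ)} {r : ℕ} {F : Fin r → (Σ j, Fin (d j)) → ℤ}
  {v : Fin r → ℕ} {ρ : Fin r → Σ j, Fin (d j + 1)}

/-- The normalized volume of a lattice simplex. -/
noncomputable def simplexVolume (s : ∀ j, Fin (d j + 1) → Fin (d j) → ℤ) (j : Fin k) : ℕ :=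
  (edgeMatrix (s j)).det.natAbs

theorem simplexVolume_pos (hs : ∀ j, AffineIndependent ℝ fun l => toReal (s j l)) (j : Fin k) :
    0 < simplexVolume s j :=
  Int.natAbs_pos.2 (det_edgeMatrix_ne_zero hs j)

theorem IsRayIndex.cast_exponent_int (hρ : IsRayIndex hs A F v ρ) (i : Fin r)
    {a : (Σ j, Fin (d j)) → ℤ} (ha : a ∈ A) :
    ((v i * coxExponent A F a i : ℕ) : ℤ) = v i * (F i ⬝ᵥ a + supportConst A (F i)) := by
  rw [Nat.cast_mul, coxExponent, Int.toNat_of_nonneg (hρ.height_nonneg i a ha)]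

theorem IsRayIndex.cast_exponent (hρ : IsRayIndex hs A F v ρ) (i : Fin r)
    {a : (Σ j, Fin (d j)) → ℤ} (ha : a ∈ A) :
    ((v i * coxExponent A F a i : ℕ) : ℝ) =
      simplexVolume s (ρ i).1 * baryCoord hs (ρ i) (toReal a) := by
  rw [simplexVolume, ← hρ.mul_height, ← hρ.cast_exponent_int i ha, Int.cast_natCast]

theorem IsRayIndex.sum_exponent (hρ : IsRayIndex hs A F v ρ) (j : {j // 0 < d j})
    {a : (Σ j, Fin (d j)) → ℤ} (ha : a ∈ A) :
    ∑ i with hρ.block i = j, v i * coxExponent A F a i = simplexVolume s j := by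
  have h : ∑ i with hρ.block i = j, ((v i * coxExponent A F a i : ℕ) : ℝ) =
      (simplexVolume s j : ℝ) := by
    rw [Finset.sum_congr rfl fun i _ => hρ.cast_exponent i ha,
      hρ.sum_block j fun q => (simplexVolume s q.1 : ℝ) * baryCoord hs q (toReal a)]
    dsimp only
    rw [← Finset.mul_sum, sum_baryCoord, mul_one]
  exact_mod_cast h

/-- Under a product of weights of total mass one, the average of a function of a single coordinate
depends only on that factor. -/
theorem sum_prod_mul (φ : ∀ j, Fin (d j + 1) → ℝ) (hφ : ∀ j, ∑ l, φ j l = 1) (j₀ : Fin k)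
    (c : Fin (d j₀ + 1) → ℝ) :
    ∑ w : ∀ j, Fin (d j + 1), (∏ j, φ j (w j)) * c (w j₀) = ∑ l, φ j₀ l * c l := by
  have h := Fintype.prod_sum (Function.update φ j₀ fun l => φ j₀ l * c l)
  rw [Fintype.prod_eq_mul_prod_compl j₀] at h
  rw [Finset.prod_eq_one (s := {j₀}ᶜ)] at h
  · simp only [Function.update_self, mul_one] at h
    rw [h]
    refine Finset.sum_congr rfl fun w _ => ?_
    rw [Fintype.prod_eq_mul_prod_compl j₀, Fintype.prod_eq_mul_prod_compl j₀ (fun j => _),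
      Function.update_self, mul_right_comm]
    congr 1
    refine Finset.prod_congr rfl fun j hj => ?_
    rw [Function.update_of_ne (by simpa using hj)]
  · intro j hj
    rw [Function.update_of_ne (by simpa using hj), hφ]

/-- The Newton polytope is everything as soon as the support contains the vertices. -/
theorem newtonPolytope_eq (hs : ∀ j, AffineIndependent ℝ fun l => toReal (s j l))
    (hA : polytope A = simplexProduct s) {f : AddMonoidAlgebra ℝ ((Σ j, Fin (d j)) → ℤ)}
    (hf : f.coeff.support ⊆ A) (hv : ∀ w, prodVertex s w ∈ f.coeff.support) :
    newtonPolytope f = polytope A := by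
  refine Set.Subset.antisymm (convexHull_mono (Set.image_mono (by exact_mod_cast hf))) ?_
  rw [hA]
  intro p hp
  have hnn := (mem_simplexProduct_iff hs p).1 hp
  have hpe : p = ∑ w : ∀ j, Fin (d j + 1),
      (∏ j, baryCoord hs ⟨j, w j⟩ p) • toReal (prodVertex s w) := by
    ext x
    rw [Finset.sum_apply, ← sum_baryCoord_mul hs p x]
    exact (sum_prod_mul (fun j l => baryCoord hs ⟨j, l⟩ p) (fun j => sum_baryCoord hs j p) x.1
      fun l => (s x.1 l x.2 : ℝ)).symm
  rw [hpe]
  refine (convex_convexHull ℝ _).sum_mem (fun w _ => Finset.prod_nonneg fun j _ => hnn _) ?_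
    fun w _ => subset_convexHull _ _ ⟨_, hv w, rfl⟩
  rw [← Fintype.prod_sum fun j l => baryCoord hs ⟨j, l⟩ p]
  exact Finset.prod_eq_one fun j _ => sum_baryCoord hs j p

theorem IsRayIndex.exists_nat_baryCoord (hρ : IsRayIndex hs A F v ρ)
    {a : (Σ j, Fin (d j)) → ℤ} (ha : a ∈ A) (q : Σ j, Fin (d j + 1)) :
    ∃ e : ℕ, (e : ℝ) = simplexVolume s q.1 * baryCoord hs q (toReal a) := by
  by_cases hq : 0 < d q.1
  · obtain ⟨i, rfl⟩ := (hρ.mem_range_iff q).2 hq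
    exact ⟨_, hρ.cast_exponent i ha⟩
  · refine ⟨simplexVolume s q.1, ?_⟩
    have h1 := sum_baryCoord hs q.1 (toReal a)
    rw [Finset.sum_eq_single q.2] at h1
    · rw [h1, mul_one]
    · intro l _ hl
      exact (hl (Fin.ext (by omega))).elim
    · simp

/-- A nonzero point of the toric variety has a nonzero coordinate at some vertex. -/
theorem IsRayIndex.exists_vertex_ne_zero (hρ : IsRayIndex hs A F v ρ)
    (hA : polytope A = simplexProduct s) {y : A → ℝ}
    (hy : (fun a => (y a : ℂ)) ∈ affineToricVariety A) {a : A} (ha : y a ≠ 0) :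
    ∃ w, y ⟨prodVertex s w, prodVertex_mem hs hA w⟩ ≠ 0 := by
  choose e he using hρ.exists_nat_baryCoord a.2
  have hw : ∀ w : ∀ j, Fin (d j + 1), ((∏ j, e ⟨j, w j⟩ : ℕ) : ℝ) =
      (∏ j, (simplexVolume s j : ℝ)) * ∏ j, baryCoord hs ⟨j, w j⟩ (toReal a) := by
    intro w
    rw [Nat.cast_prod, ← Finset.prod_mul_distrib]
    exact Finset.prod_congr rfl fun j _ => he _
  have hdeg : ∏ j, simplexVolume s j = ∑ w : ∀ j, Fin (d j + 1), ∏ j, e ⟨j, w j⟩ := by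
    have : ((∏ j, simplexVolume s j : ℕ) : ℝ) =
        ∑ w : ∀ j, Fin (d j + 1), ((∏ j, e ⟨j, w j⟩ : ℕ) : ℝ) := by
      rw [Finset.sum_congr rfl fun w _ => hw w, ← Finset.mul_sum,
        ← Fintype.prod_sum fun j l => baryCoord hs ⟨j, l⟩ (toReal a),
        Finset.prod_eq_one fun j _ => sum_baryCoord hs j _, mul_one, Nat.cast_prod]
    exact_mod_cast this
  have hwt : ∀ x : Σ j, Fin (d j), ((∏ j, simplexVolume s j : ℕ) : ℤ) * (a : _ → ℤ) x =
      ∑ w : ∀ j, Fin (d j + 1), ((∏ j, e ⟨j, w j⟩ : ℕ) : ℤ) * prodVertex s w x := by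
    intro x
    have h1 := sum_prod_mul (fun j l => baryCoord hs ⟨j, l⟩ (toReal a))
      (fun j => sum_baryCoord hs j _) x.1 fun l => (s x.1 l x.2 : ℝ)
    rw [sum_baryCoord_mul] at h1
    have : (((∏ j, simplexVolume s j : ℕ) : ℝ)) * toReal (a : _ → ℤ) x =
        ∑ w : ∀ j, Fin (d j + 1), ((∏ j, e ⟨j, w j⟩ : ℕ) : ℝ) * (prodVertex s w x : ℝ) := by
      rw [← h1, Finset.mul_sum]
      refine Finset.sum_congr rfl fun w _ => ?_
      rw [hw, Nat.cast_prod, mul_assoc]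
      rfl
    simp only [toReal] at this
    exact_mod_cast this
  -- The point `a` is the barycenter of the vertices with weights ∏ λ_{j, w j}(a). Clearing
  -- denominators gives an equation expressing a power of y_a as a product of powers of vertex
  -- coordinates.
  have hbin := binomial_of_mem_affineToricVariety hy (fun _ : Unit => a)
    (fun _ => ∏ j, simplexVolume s j) (fun w => ⟨prodVertex s w, prodVertex_mem hs hA w⟩)
    (fun w : ∀ j, Fin (d j + 1) => ∏ j, e ⟨j, w j⟩) (by simpa using hdeg)
    (fun x => by simpa using hwt x)
  by_contra hcon
  push Not at hcon
  simp only [Finset.univ_unique, Finset.prod_singleton, hcon] at hbin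
  obtain ⟨w, -, hne⟩ : ∃ w ∈ Finset.univ, ∏ j, e ⟨j, (w : ∀ j, Fin (d j + 1)) j⟩ ≠ 0 := by
    refine Finset.exists_ne_zero_of_sum_ne_zero ?_
    rw [← hdeg]
    exact Finset.prod_ne_zero_iff.2 fun j _ => (simplexVolume_pos hs j).ne'
  rw [Finset.prod_eq_zero (Finset.mem_univ w) (zero_pow hne)] at hbin
  exact pow_ne_zero _ ha hbin

/-- Nonnegative points of the toric variety come from nonnegative Cox coordinates. -/
theorem IsRayIndex.exists_cox_coordinates (hρ : IsRayIndex hs A F v ρ)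
    (hA : polytope A = simplexProduct s) {y : A → ℝ} (hy0 : ∀ a, 0 ≤ y a)
    (hy : (fun a => (y a : ℂ)) ∈ affineToricVariety A) {w : ∀ j, Fin (d j + 1)}
    (hw : y ⟨prodVertex s w, prodVertex_mem hs hA w⟩ ≠ 0) :
    ∃ x : Fin r → ℝ, (∀ i, 0 ≤ x i) ∧ (∀ i, w (ρ i).1 = (ρ i).2 → x i = 1) ∧
      ∀ a : A, y a = y ⟨prodVertex s w, prodVertex_mem hs hA w⟩ *
        ∏ i, x i ^ (v i * coxExponent A F a i) := by
  let ver : (∀ j, Fin (d j + 1)) → A := fun w => ⟨prodVertex s w, prodVertex_mem hs hA w⟩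
  let nb : Fin r → A := fun i => ver (Function.update w (ρ i).1 (ρ i).2)
  have hw' : 0 < y (ver w) := lt_of_le_of_ne (hy0 _) hw.symm
  have hD : ∀ j, simplexVolume s j ≠ 0 := fun j => (simplexVolume_pos hs j).ne'
  -- The vertex `nb i` is `w` moved, in one factor, to the vertex opposite to the i-th facet. Its
  -- monomial should be x_i to the power V_j, which dictates this root.
  let x : Fin r → ℝ := fun i => (y (nb i) / y (ver w)) ^ ((simplexVolume s (ρ i).1 : ℝ)⁻¹)
  have hx : ∀ i, y (nb i) = y (ver w) * x i ^ simplexVolume s (ρ i).1 := by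
    intro i
    rw [Real.rpow_inv_natCast_pow (div_nonneg (hy0 _) (hy0 _)) (hD _), mul_div_cancel₀ _ hw'.ne']
  have hx0 : ∀ i, 0 ≤ x i := fun i => Real.rpow_nonneg (div_nonneg (hy0 _) (hy0 _)) _
  refine ⟨x, hx0, fun i hi => ?_, fun a => ?_⟩
  · have : nb i = ver w := by
      simp only [nb, ← hi, Function.update_eq_self]
    simp only [x, this, div_self hw'.ne', Real.one_rpow]
  · let L : ℕ := ∏ j, simplexVolume s j
    have hL : L ≠ 0 := Finset.prod_ne_zero_iff.2 fun j _ => hD j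
    let n : Fin r → ℕ := fun i =>
      (∏ j ∈ {(ρ i).1}ᶜ, simplexVolume s j) * (v i * coxExponent A F a i)
    have hn : ∀ i, simplexVolume s (ρ i).1 * n i = L * (v i * coxExponent A F a i) := by
      intro i
      rw [← mul_assoc, ← Fintype.prod_eq_mul_prod_compl]
    have hnR : ∀ i, (n i : ℝ) = L * baryCoord hs (ρ i) (toReal a) := by
      intro i
      have h1 : (simplexVolume s (ρ i).1 : ℝ) * n i =
          simplexVolume s (ρ i).1 * (L * baryCoord hs (ρ i) (toReal a)) := by
        rw [← Nat.cast_mul, hn, Nat.cast_mul, hρ.cast_exponent i a.2]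
        ring
      exact mul_left_cancel₀ (Nat.cast_ne_zero.2 (hD _)) h1
    -- This is the identity a - w = ∑ λ_{ρ i}(a) (nb i - w), multiplied by `L` to make the weights
    -- integral and rearranged without subtraction.
    have hwt : ∀ x, (L : ℤ) * (a : _ → ℤ) x + (∑ i, n i : ℕ) * prodVertex s w x =
        L * prodVertex s w x + ∑ i, (n i : ℤ) * (nb i : _ → ℤ) x := by
      intro x
      let G : (Σ j, Fin (d j + 1)) → ℝ := fun q => L * baryCoord hs q (toReal a) *
        ((prodVertex s (Function.update w q.1 q.2) x : ℝ) - prodVertex s w x)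
      have hG : ∑ i, G (ρ i) = L * ((a : _ → ℤ) x - prodVertex s w x) := by
        rw [hρ.sum_comp G, Fintype.sum_sigma, Finset.sum_eq_single x.1]
        · have h1 : ∀ l, G ⟨x.1, l⟩ = L * (baryCoord hs ⟨x.1, l⟩ (toReal a) * s x.1 l x.2) -
              L * (baryCoord hs ⟨x.1, l⟩ (toReal a) * prodVertex s w x) := by
            intro l
            simp only [G, prodVertex, Function.update_self]
            ring
          simp only [h1, Finset.sum_sub_distrib, ← Finset.mul_sum]
          rw [sum_baryCoord_mul, ← Finset.sum_mul, sum_baryCoord]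
          simp only [toReal]
          ring
        · intro j _ hj
          refine Finset.sum_eq_zero fun l _ => ?_
          simp [G, prodVertex, Function.update_of_ne (Ne.symm hj)]
        · simp
        · intro q hq
          have : w q.1 = q.2 := Fin.ext (by omega)
          simp [G, ← this]
      have h2 : ∑ i, G (ρ i) =
          ∑ i, (n i : ℝ) * (nb i : _ → ℤ) x - (∑ i, (n i : ℝ)) * prodVertex s w x := by
        rw [Finset.sum_mul, ← Finset.sum_sub_distrib]
        refine Finset.sum_congr rfl fun i _ => ?_
        rw [hnR, ← mul_sub]
      have h3 : (L : ℝ) * (a : _ → ℤ) x + (∑ i, n i : ℕ) * prodVertex s w x =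
          L * prodVertex s w x + ∑ i, (n i : ℝ) * (nb i : _ → ℤ) x := by
        rw [Nat.cast_sum]
        linarith
      exact_mod_cast h3
    have hbin := binomial_of_mem_affineToricVariety hy
      (fun b : Bool => if b then a else ver w) (fun b => if b then L else ∑ i, n i)
      (fun o : Option (Fin r) => o.elim (ver w) nb) (fun o => o.elim L n)
      (by simp [Fintype.sum_option]) (fun x => by simpa [Fintype.sum_option] using hwt x)
    simp only [Fintype.prod_bool, Fintype.prod_option, if_true, Bool.false_eq_true, if_false,
      Option.elim] at hbin
    have h4 : ∏ i, y (nb i) ^ n i =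
        y (ver w) ^ (∑ i, n i) * (∏ i, x i ^ (v i * coxExponent A F a i)) ^ L := by
      rw [← Finset.prod_pow_eq_pow_sum, ← Finset.prod_pow, ← Finset.prod_mul_distrib]
      refine Finset.prod_congr rfl fun i _ => ?_
      rw [hx, mul_pow, ← pow_mul, ← pow_mul, hn, mul_comm L]
    rw [h4, mul_left_comm, ← mul_pow, mul_comm] at hbin
    have h5 := mul_left_cancel₀ (pow_ne_zero _ hw'.ne') hbin
    -- The binomial equation only yields equality of `L`-th powers; nonnegativity makes the root
    -- unique.
    exact (pow_left_inj₀ (hy0 a) (mul_nonneg hw'.le (Finset.prod_nonneg fun i _ =>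
      pow_nonneg (hx0 i) _)) hL).1 h5

/-- On the indicator of a vertex, only the monomial of that vertex survives. -/
theorem IsRayIndex.prod_indicator_pow (hρ : IsRayIndex hs A F v ρ) (w : ∀ j, Fin (d j + 1))
    {a : (Σ j, Fin (d j)) → ℤ} (ha : a ∈ A) :
    ∏ i, (if w (ρ i).1 = (ρ i).2 then (1 : ℝ) else 0) ^ (v i * coxExponent A F a i) =
      if a = prodVertex s w then 1 else 0 := by
  have hexp : ∀ i, v i * coxExponent A F a i = 0 ↔ baryCoord hs (ρ i) (toReal a) = 0 := by
    intro i
    rw [← Nat.cast_eq_zero (R := ℝ), hρ.cast_exponent i ha, mul_eq_zero, or_iff_right]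
    exact Nat.cast_ne_zero.2 (simplexVolume_pos hs _).ne'
  split_ifs with h
  · refine Finset.prod_eq_one fun i _ => ?_
    split_ifs with hi
    · exact one_pow _
    · rw [(hexp i).2, pow_zero]
      rw [h, baryCoord_vertex, if_neg hi]
  · obtain ⟨i, hi, hi'⟩ : ∃ i, w (ρ i).1 ≠ (ρ i).2 ∧ baryCoord hs (ρ i) (toReal a) ≠ 0 := by
      by_contra hcon
      push Not at hcon
      refine h (toReal_injective (eq_of_baryCoord_eq hs fun q => ?_))
      have hzero : ∀ j l, w j ≠ l → baryCoord hs ⟨j, l⟩ (toReal a) = 0 := by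
        intro j l hl
        have hd : 0 < d j := by
          rw [Nat.pos_iff_ne_zero]
          intro hd
          exact hl (Fin.ext (by omega))
        obtain ⟨i, hi⟩ := hρ.exists_eq hd l
        rw [← hi]
        refine hcon i ?_
        rw [hi]
        exact hl
      obtain ⟨j, l⟩ := q
      rw [baryCoord_vertex]
      split_ifs with hl
      · dsimp only at hl
        have h1 := sum_baryCoord hs j (toReal a)
        rw [Finset.sum_eq_single (w j)] at h1
        · rw [← hl, h1]
        · exact fun l' _ hl' => hzero j l' hl'.symm
        · simp
      · exact hzero j l hl
    refine Finset.prod_eq_zero (Finset.mem_univ i) ?_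
    rw [if_neg hi, zero_pow]
    rwa [Ne, hexp]

end Parametrization

/-! ### Positivity certificates and copositivity. -/

section Certificates

theorem powSubst_coxHom {ι : Type*} [Fintype ι] {r : ℕ} (A : Finset (ι → ℤ))
    (F : Fin r → ι → ℤ) (v : Fin r → ℕ) (f : AddMonoidAlgebra ℝ (ι → ℤ)) :
    powSubst v (coxHom A F f) = ∑ a ∈ A, monomial (Finsupp.equivFunOnFinite.symm fun i =>
      v i * coxExponent A F a i) (f.coeff a) := by
  rw [powSubst, coxHom, map_sum]
  refine Finset.sum_congr rfl fun a _ => ?_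
  rw [bind₁_monomial, monomial_eq, Finsupp.prod_fintype _ _ fun i => pow_zero _,
    Finset.prod_subset (Finset.subset_univ _)]
  · simp [pow_mul]
  · intro i _ hi
    rw [Finsupp.notMem_support_iff.1 hi, pow_zero]

theorem eval_le_eval_of_nonnegCoeffs {r : ℕ} {p : MvPolynomial (Fin r) ℝ} (hp : NonnegCoeffs p)
    {x x' : Fin r → ℝ} (hx : ∀ i, 0 ≤ x i) (hxx' : ∀ i, x i ≤ x' i) : eval x p ≤ eval x' p := by
  rw [eval_eq', eval_eq']
  refine Finset.sum_le_sum fun m _ => mul_le_mul_of_nonneg_left ?_ (hp m)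
  exact Finset.prod_le_prod (fun i _ => pow_nonneg (hx i) _)
    fun i _ => pow_le_pow_left₀ (hx i) (hxx' i) _

variable {k : ℕ} {d : Fin k → ℕ} {s : ∀ j, Fin (d j + 1) → Fin (d j) → ℤ}
  {hs : ∀ j, AffineIndependent ℝ fun l => toReal (s j l)}
  {A : Finset ((Σ j, Fin (d j)) → ℤ)} {r : ℕ} {F : Fin r → (Σ j, Fin (d j)) → ℤ}
  {v : Fin r → ℕ} {ρ : Fin r → Σ j, Fin (d j + 1)}
  {f : AddMonoidAlgebra ℝ ((Σ j, Fin (d j)) → ℤ)}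

theorem eval_powSubst_coxHom (A : Finset ((Σ j, Fin (d j)) → ℤ))
    (F : Fin r → (Σ j, Fin (d j)) → ℤ) (v : Fin r → ℕ)
    (f : AddMonoidAlgebra ℝ ((Σ j, Fin (d j)) → ℤ)) (x : Fin r → ℝ) :
    eval x (powSubst v (coxHom A F f)) =
      ∑ a ∈ A, f.coeff a * ∏ i, x i ^ (v i * coxExponent A F a i) := by
  rw [powSubst_coxHom, map_sum]
  refine Finset.sum_congr rfl fun a _ => ?_
  rw [eval_monomial, Finsupp.prod_fintype _ _ fun i => pow_zero _]
  rfl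

theorem IsRayIndex.eval_indicator (hρ : IsRayIndex hs A F v ρ)
    (hA : polytope A = simplexProduct s) (w : ∀ j, Fin (d j + 1)) :
    eval (fun i => if w (ρ i).1 = (ρ i).2 then (1 : ℝ) else 0) (powSubst v (coxHom A F f)) =
      f.coeff (prodVertex s w) := by
  rw [eval_powSubst_coxHom, Finset.sum_congr rfl fun a ha => by rw [hρ.prod_indicator_pow w ha]]
  simp [prodVertex_mem hs hA w]

theorem StrictlyCopositive.eval_pos (hρ : IsRayIndex hs A F v ρ)
    (hA : polytope A = simplexProduct s) (h : StrictlyCopositive A f) {x : Fin r → ℝ}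
    (hx : ∀ i, 0 ≤ x i) {w : ∀ j, Fin (d j + 1)} (hw : ∀ i, w (ρ i).1 = (ρ i).2 → x i ≠ 0) :
    0 < eval x (powSubst v (coxHom A F f)) := by
  rw [eval_powSubst_coxHom]
  have h1 := h (fun a => ∏ i, x i ^ (v i * coxExponent A F a i))
    (fun a => Finset.prod_nonneg fun i _ => pow_nonneg (hx i) _) ?_ ?_
  · rwa [Finset.sum_coe_sort A fun a => f.coeff a * ∏ i, x i ^ (v i * coxExponent A F a i)] at h1
  · intro h0
    have h1 := congrFun h0 ⟨prodVertex s w, prodVertex_mem hs hA w⟩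
    refine Finset.prod_ne_zero_iff.2 (fun i _ => ?_) h1
    by_cases hi : w (ρ i).1 = (ρ i).2
    · exact pow_ne_zero _ (hw i hi)
    · have h2 := hρ.cast_exponent i (prodVertex_mem hs hA w)
      rw [baryCoord_vertex, if_neg hi, mul_zero, Nat.cast_eq_zero] at h2
      dsimp only
      rw [h2, pow_zero]
      exact one_ne_zero
  · refine monomial_mem_affineToricVariety (fun a i => v i * coxExponent A F a i)
      (fun i => (v i : ℤ) • F i) (fun i => v i * supportConst A (F i)) (fun a i => ?_) x hx
    rw [hρ.cast_exponent_int i a.2, smul_dotProduct, smul_eq_mul, mul_add]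

theorem StrictlyCopositive.newtonPolytope_eq (hρ : IsRayIndex hs A F v ρ)
    (hA : polytope A = simplexProduct s) (hf : f.coeff.support ⊆ A)
    (h : StrictlyCopositive A f) : newtonPolytope f = polytope A := by
  refine SparseCox.newtonPolytope_eq hs hA hf fun w => ?_
  have h1 := h.eval_pos hρ hA (w := w)
    (x := fun i => if w (ρ i).1 = (ρ i).2 then (1 : ℝ) else 0)
    (fun i => by split_ifs <;> norm_num) (fun i hi => by simp [hi])
  rw [hρ.eval_indicator hA] at h1
  exact Finsupp.mem_support_iff.2 h1.ne'

theorem StrictlyCopositive.exists_coeff_pos (hρ : IsRayIndex hs A F v ρ)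
    (hA : polytope A = simplexProduct s) (h : StrictlyCopositive A f) :
    ∃ N : ℕ, ∀ m ∈ (irrelevantSum A F ^ N).support, ∀ a ∈ A,
      0 < (irrelevantSum A F ^ N * powSubst v (coxHom A F f)).coeff
        (m + Finsupp.equivFunOnFinite.symm fun i => v i * coxExponent A F a i) := by
  have hE : ∀ a ∈ A, ∀ j, ∑ i with hρ.block i = j, v i * coxExponent A F a i =
      simplexVolume s j := fun a ha j => hρ.sum_exponent j ha
  obtain ⟨N, hN⟩ := exists_coeff_prod_blockSum_pow_mul_pos hρ.block A (fun a => f.coeff a)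
    (fun a i => v i * coxExponent A F a i) (fun j => simplexVolume s j) hE fun x hx hx1 => by
      rw [← eval_powSubst_coxHom]
      -- A block with sum 1 has a nonzero variable; choosing one per block gives a vertex whose
      -- monomial does not vanish at `x`.
      have hex : ∀ j, ∃ l, ∀ i, ρ i = ⟨j, l⟩ → x i ≠ 0 := by
        intro j
        by_cases hj : 0 < d j
        · obtain ⟨i, hi, hne⟩ := Finset.exists_ne_zero_of_sum_ne_zero
            ((hx1 ⟨j, hj⟩).trans_ne one_ne_zero)
          have hi' := (Finset.mem_filter.1 hi).2
          rw [hρ.block_eq_iff] at hi'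
          dsimp only at hi'
          subst hi'
          refine ⟨(ρ i).2, fun i' hi' => ?_⟩
          rwa [hρ.injective hi']
        · exact ⟨0, fun i hi => (hj ((hρ.mem_range_iff ⟨j, 0⟩).1 ⟨i, hi⟩)).elim⟩
      choose w hw using hex
      exact h.eval_pos hρ hA hx fun i hi => hw _ i (Sigma.ext rfl (heq_of_eq hi.symm))
  refine ⟨N, fun m hm a ha => ?_⟩
  rw [hρ.irrelevantSum_eq hA] at hm ⊢
  rw [powSubst_coxHom]
  refine hN _ fun j => ?_
  have h1 := (hasMultinomialCoeffs_prod_pow hρ.block N).sum_eq_of_mem_support hm j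
  rw [← hE a ha j, ← h1, ← Finset.sum_add_distrib]
  rfl

theorem nonnegCoeffs_of_coeff_pos {h : MvPolynomial (Fin r) ℝ}
    (hpos : ∀ m ∈ h.support, ∀ a ∈ A, 0 < (h * powSubst v (coxHom A F f)).coeff
      (m + Finsupp.equivFunOnFinite.symm fun i => v i * coxExponent A F a i)) :
    NonnegCoeffs (h * powSubst v (coxHom A F f)) := by
  intro m
  by_contra hneg
  have hne : (h * powSubst v (coxHom A F f)).coeff m ≠ 0 := fun h0 => hneg h0.ge
  rw [powSubst_coxHom, Finset.mul_sum, coeff_sum] at hne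
  obtain ⟨a, ha, hne⟩ := Finset.exists_ne_zero_of_sum_ne_zero hne
  rw [coeff_mul_monomial'] at hne
  split_ifs at hne with hle
  · have h1 := hpos _ (mem_support_iff.2 (left_ne_zero_of_mul hne)) a ha
    rw [tsub_add_cancel_of_le hle] at h1
    exact hneg h1.le
  · exact hne rfl

theorem IsRayIndex.strictlyCopositive (hρ : IsRayIndex hs A F v ρ)
    (hA : polytope A = simplexProduct s) {N : Finset (Fin r) → ℕ}
    (hN : NonnegCoeffs ((∏ C ∈ primitiveCollections A F, (∑ i ∈ C, X i) ^ N C) *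
      powSubst v (coxHom A F f)))
    (hnewton : newtonPolytope f = polytope A) : StrictlyCopositive A f := by
  intro y hy0 hyne hy
  obtain ⟨a, ha⟩ := Function.ne_iff.1 hyne
  obtain ⟨w, hw⟩ := hρ.exists_vertex_ne_zero hA hy ha
  obtain ⟨x, hx0, hx1, hxy⟩ := hρ.exists_cox_coordinates hA hy0 hy hw
  have hmult : ∀ z : Fin r → ℝ, (∀ i, 0 ≤ z i) → (∀ i, w (ρ i).1 = (ρ i).2 → z i = 1) →
      0 < eval z (∏ C ∈ primitiveCollections A F,
        (∑ i ∈ C, X i : MvPolynomial (Fin r) ℝ) ^ N C) := by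
    intro z hz0 hz1
    rw [map_prod]
    refine Finset.prod_pos fun C hC => ?_
    rw [map_pow, map_sum]
    refine pow_pos (Finset.sum_pos' (fun i _ => by simpa using hz0 i) ?_) _
    obtain ⟨j, rfl⟩ := (hρ.mem_primitiveCollections_iff hA C).1 hC
    obtain ⟨i, hi⟩ := hρ.exists_eq j.2 (w j)
    refine ⟨i, by simp [hρ.block_eq_iff, hi], ?_⟩
    rw [eval_X, hz1 i (by rw [hi])]
    exact one_pos
  let χ : Fin r → ℝ := fun i => if w (ρ i).1 = (ρ i).2 then 1 else 0
  have hχ0 : ∀ i, 0 ≤ χ i := fun i => by simp only [χ]; split_ifs <;> norm_num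
  have hχ1 : ∀ i, w (ρ i).1 = (ρ i).2 → χ i = 1 := fun i hi => if_pos hi
  have hχx : ∀ i, χ i ≤ x i := by
    intro i
    by_cases hi : w (ρ i).1 = (ρ i).2
    · rw [hχ1 i hi, hx1 i hi]
    · simp only [χ, if_neg hi, hx0 i]
  have hmono := eval_le_eval_of_nonnegCoeffs hN hχ0 hχx
  -- `prodVertex_mem` is applied to the support of `f` in place of `A`, which is legitimate because
  -- the Newton polytope is the whole product.
  have hvert : f.coeff (prodVertex s w) ≠ 0 :=
    Finsupp.mem_support_iff.1 (prodVertex_mem hs (hnewton.trans hA) w)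
  have hpos : 0 < eval x (powSubst v (coxHom A F f)) := by
    have hχ : eval χ (powSubst v (coxHom A F f)) = f.coeff (prodVertex s w) :=
      hρ.eval_indicator hA w
    have hnn : 0 ≤ eval χ ((∏ C ∈ primitiveCollections A F, (∑ i ∈ C, X i) ^ N C) *
        powSubst v (coxHom A F f)) := by
      rw [eval_eq']
      exact Finset.sum_nonneg fun m _ =>
        mul_nonneg (hN m) (Finset.prod_nonneg fun i _ => pow_nonneg (hχ0 i) _)
    rw [map_mul, map_mul, hχ] at hmono
    rw [map_mul, hχ] at hnn
    have h1 : 0 < eval χ (∏ C ∈ primitiveCollections A F,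
        (∑ i ∈ C, X i : MvPolynomial (Fin r) ℝ) ^ N C) * f.coeff (prodVertex s w) :=
      lt_of_le_of_ne hnn (mul_ne_zero (hmult χ hχ0 hχ1).ne' hvert).symm
    -- Only the product is known to be monotone; positivity of the multiplier at `x` transfers the
    -- sign to the second factor.
    exact pos_of_mul_pos_right (h1.trans_le hmono) (hmult x hx0 hx1).le
  rw [eval_powSubst_coxHom] at hpos
  have hsum : ∑ a : A, f.coeff (a : _ → ℤ) * y a =
      y ⟨prodVertex s w, prodVertex_mem hs hA w⟩ *
        ∑ a ∈ A, f.coeff a * ∏ i, x i ^ (v i * coxExponent A F a i) := by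
    rw [← Finset.sum_coe_sort A, Finset.mul_sum]
    refine Finset.sum_congr rfl fun a _ => ?_
    rw [hxy a, mul_left_comm]
  rw [hsum]
  exact mul_pos (lt_of_le_of_ne (hy0 _) hw.symm) hpos

end Certificates

end SparseCox

open SparseCox MvPolynomial in
theorem theorem4p11 {k : ℕ} (d : Fin k → ℕ)
    -- the vertices `s j l` of the simplices `Δ_j ⊆ ℝ^{d j}`
    (s : ∀ j, Fin (d j + 1) → Fin (d j) → ℤ)
    (hs : ∀ j, AffineIndependent ℝ fun l => toReal (s j l))
    (A : Finset ((Σ j, Fin (d j)) → ℤ))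
    (hA : polytope A = simplexProduct s)
    -- `F` enumerates the primitive ray generators of the inner normal fan of `conv(A)`
    (r : ℕ) (F : Fin r → (Σ j, Fin (d j)) → ℤ)
    (hF_inj : Function.Injective F)
    (hF_range : Set.range F = {u | IsRayGenerator (polytope A) u})
    (v : Fin r → ℕ) (hv : ∀ i, v i = facetVolume s A (F i))
    (f : AddMonoidAlgebra ℝ ((Σ j, Fin (d j)) → ℤ))
    (hf : f.coeff.support ⊆ A) :
    List.TFAE [
      StrictlyCopositive A f,
      (∃ N : Finset (Fin r) → ℕ,
        NonnegCoeffs ((∏ C ∈ primitiveCollections A F, (∑ i ∈ C, X i) ^ N C) *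
          powSubst v (coxHom A F f))) ∧
        newtonPolytope f = polytope A,
      -- positive coefficients: at every exponent `m + (v_i (Fᵀ a + b)_i)_i` with `m` in the support
      -- of the multiplier and `a ∈ A`; no other exponent occurs in the product
      (∃ N : ℕ, ∀ m ∈ (irrelevantSum A F ^ N).support, ∀ a ∈ A,
        0 < (irrelevantSum A F ^ N * powSubst v (coxHom A F f)).coeff
          (m + Finsupp.equivFunOnFinite.symm fun i => v i * coxExponent A F a i)) ∧
        newtonPolytope f = polytope A,
      (∃ N : ℕ, NonnegCoeffs (irrelevantSum A F ^ N * powSubst v (coxHom A F f))) ∧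
        newtonPolytope f = polytope A] := by
  obtain ⟨ρ, hρ⟩ := exists_isRayIndex hs hA hF_inj hF_range hv
  tfae_have 1 → 3 := fun h =>
    ⟨h.exists_coeff_pos hρ hA, h.newtonPolytope_eq hρ hA hf⟩
  tfae_have 3 → 4 := fun ⟨⟨N, hN⟩, h⟩ => ⟨⟨N, nonnegCoeffs_of_coeff_pos hN⟩, h⟩
  tfae_have 4 → 2 := fun ⟨⟨N, hN⟩, h⟩ => by
    refine ⟨⟨fun _ => N, ?_⟩, h⟩
    rwa [hρ.prod_primitiveCollections hA, ← hρ.irrelevantSum_eq hA]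
  tfae_have 2 → 1 := fun ⟨⟨N, hN⟩, h⟩ => hρ.strictlyCopositive hA hN h
  tfae_finish
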